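/- **Theorem 1.1.** Let $N\ge1$ be an integer and $s\in(0,1)$. For a non-empty open set $\Omega\subsetneq\mathbb R^N$, let $d_\Omega(x)=\inf_{y\in\partial\Omega}|x-y|$ and $$\mathfrak h_{s,1}(\Omega)=\inf\left\{\int_{\mathbb R^N}\int_{\mathbb R^N}\frac{|u(x)-u(y)|}{|x-y|^{N+s}}\,dx\,dy\;:\;u\in C_0^\infty(\Omega),\ \int_\Omega\frac{|u|}{d_\Omega^{s}}\,dx=1\right\},$$ where $C_0^\infty(\Omega)$ is the set of smooth functions on $\mathbb R^N$ with compact support contained in $\Omega$. Let $\mathbb H^1_+=(0,\infty)$ and $\mathbb H^N_+=(0,\infty)\times\mathbb R^{N-1}$ for $N\ge2$. Let $C_{1,s}=1$ and, for $N\ge2$, $$C_{N,s}=(N-1)\,\omega_{N-1}\int_0^\infty\frac{t^{N-2}}{(1+t^2)^{\frac{N+s}2}}\,dt,$$ where $\omega_k$ is the Lebesgue measure of the unit ball of $\mathbb R^k$, and let $$\Lambda_{s,1}=2\int_0^1\frac{|1-t^{s-1}|}{(1-t)^{1+s}}\,dt+\frac2s.$$ Then $$\mathfrak h_{s,1}(\mathbb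 H^N_+)=\Lambda_{s,1}\,C_{N,s}\qquad\text{with}\qquad\Lambda_{s,1}=\frac4s,$$ and, for every non-empty convex open set $\Omega\subsetneq\mathbb R^N$, $$\frac12\,\mathfrak h_{s,1}(\mathbb H^N_+)\le\mathfrak h_{s,1}(\Omega)\le\mathfrak h_{s,1}(\mathbb H^N_+).$$ -/

import Mathlib

open scoped ENNReal ContDiff

namespace FracHardy

/-- The space `C₀^∞(Ω)`: smooth real functions on `ℝ^N` with compact support contained in `Ω`. -/
def testFunctions {N : ℕ} (Ω : Set (EuclideanSpace ℝ (Fin N))) :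
    Set (EuclideanSpace ℝ (Fin N) → ℝ) :=
  {u | ContDiff ℝ ∞ u ∧ HasCompactSupport u ∧ tsupport u ⊆ Ω}

/-- The distance `d_Ω(x) = inf_{y ∈ ∂Ω} |x - y|` from the boundary of `Ω`. -/
noncomputable def bdryDist {N : ℕ} (Ω : Set (EuclideanSpace ℝ (Fin N)))
    (x : EuclideanSpace ℝ (Fin N)) : ℝ :=
  Metric.infDist x (frontier Ω)

/-- The Sobolev--Slobodeckii seminorm of `u` on `A`,
`(∫_A ∫_A |u(x) - u(y)|^p / |x - y|^(N + s p) dx dy)^(1/p)`, with values in `[0, ∞]`. -/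
noncomputable def fracSeminorm {N : ℕ} (s p : ℝ) (A : Set (EuclideanSpace ℝ (Fin N)))
    (u : EuclideanSpace ℝ (Fin N) → ℝ) : ℝ≥0∞ :=
  (∫⁻ y in A, ∫⁻ x in A,
    ENNReal.ofReal (|u x - u y| ^ p / ‖x - y‖ ^ ((N : ℝ) + s * p))) ^ (1 / p)

/-- The weighted integral `∫_Ω |u|^p / d_Ω^(s p) dx`, with values in `[0, ∞]`. -/
noncomputable def hardyIntegral {N : ℕ} (s p : ℝ) (Ω : Set (EuclideanSpace ℝ (Fin N)))
    (u : EuclideanSpace ℝ (Fin N) → ℝ) : ℝ≥0∞ :=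
  ∫⁻ x in Ω, ENNReal.ofReal (|u x| ^ p / bdryDist Ω x ^ (s * p))

/-- The sharp fractional Hardy constant `h_{s,p}(Ω)`: the infimum of `[u]^p_{W^{s,p}(ℝ^N)}` over
all `u ∈ C₀^∞(Ω)` such that `∫_Ω |u|^p / d_Ω^(s p) dx = 1`. -/
noncomputable def hardyConst {N : ℕ} (s p : ℝ) (Ω : Set (EuclideanSpace ℝ (Fin N))) : ℝ≥0∞ :=
  sInf {c | ∃ u ∈ testFunctions Ω, hardyIntegral s p Ω u = 1 ∧
    c = fracSeminorm s p Set.univ u ^ p}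

/-- The half-space `(0, ∞) × ℝ^(N-1)` in `ℝ^N`, for `N ≥ 1`. -/
def halfSpace (N : ℕ) [NeZero N] : Set (EuclideanSpace ℝ (Fin N)) :=
  {x | 0 < x 0}

/-- The constant `C_{N,q}`: it is `1` for `N = 1`, and for `N ≥ 2` it is
`(N - 1) ω_{N-1} ∫_0^∞ t^(N-2) / (1 + t^2)^((N+q)/2) dt`,
where `ω_k` is the Lebesgue measure of the unit ball of `ℝ^k`. -/
noncomputable def constC (N : ℕ) (q : ℝ) : ℝ≥0∞ :=
  if N = 1 then 1
  else ((N - 1 : ℕ) : ℝ≥0∞) *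
    MeasureTheory.volume (Metric.ball (0 : EuclideanSpace ℝ (Fin (N - 1))) 1) *
    ∫⁻ t in Set.Ioi (0 : ℝ), ENNReal.ofReal (t ^ (N - 2) / (1 + t ^ 2) ^ (((N : ℝ) + q) / 2))

/-- The constant
`Λ_{s,p} = 2 ∫_0^1 |1 - t^((s p - 1)/p)|^p / (1 - t)^(1 + s p) dt + 2 / (s p)`. -/
noncomputable def constLambda (s p : ℝ) : ℝ≥0∞ :=
  2 * (∫⁻ t in Set.Ioo (0 : ℝ) 1,
    ENNReal.ofReal (|1 - t ^ ((s * p - 1) / p)| ^ p / (1 - t) ^ (1 + s * p))) +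
  ENNReal.ofReal (2 / (s * p))

end FracHardy

open FracHardy

/-! The kernel `|z|^{-(N+s)}`, integrated over a hyperplane at height `t ≠ 0`, equals `C_{N,s}
|t|^{-(1+s)}`, and a half-space at distance `a` from a point therefore has kernel mass `C_{N,s}
a^{-s} / s`. All the constants come from this one-dimensional reduction (`lintegral_mul_kern`);
`Λ_{s,1}` is computed from an explicit antiderivative.

Lower bound for the half-space (`halfSpace_le_hardyConst`). Put `W = C_{N,s} s⁻¹ ∫ |u| x₀^{-s}`.
Pairs with one point on each side of the boundary hyperplane contribute `2W`. Pairs inside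
contribute another `2W`: if `x` lies below `y`, use `|u(x) - u(y)| ≥ |u(x)| - |u(y)|`. A point sees
the whole half-line above it but only a bounded segment below it, and the missing part is exactly
the mass of `(-∞, 0)`. Both masses are infinite, so heights are kept at least `ε` apart before
subtracting.

Upper bound for the half-space (`hardyConst_halfSpace_le`). The bound is approached by `φ(x₀)
ψ(x')`, with `φ` a smoothed indicator of a short interval `(0, l)`. Line energy and Hardy integral
are of order `l^{1-s}` with ratio tending to `4/s`, while the tangential energy carries a factor `l`
and disappears as `l → 0`.

For convex `Ω`, the complement seen from `y` contains a half-space at distance at most `d_Ω(y)`;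
using only pairs across the boundary gives half of the constant (`convex_le_hardyConst`).
Conversely, small copies of a test function of the half-space fit into `Ω` at a boundary point
touched by an interior ball, and the supporting hyperplane there can only increase the Hardy
integral (`hardyConst_le_halfSpace`). -/

namespace FracHardy

open MeasureTheory Set Filter Topology

open scoped InnerProductSpace

/-! ### Energy, Hardy integral and the homogeneous form of the Hardy inequality. -/

section Energy

variable {N : ℕ}

/-- The kernel `|z|^{-(N+s)}`. -/
noncomputable def kern (s : ℝ) (z : EuclideanSpace ℝ (Fin N)) : ℝ≥0∞ :=
  ENNReal.ofReal (‖z‖ ^ ((N : ℝ) + s))⁻¹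

/-- The `W^{s,1}` energy `∫∫ |u(x) - u(y)| |x - y|^{-(N+s)} dx dy`. -/
noncomputable def energy (s : ℝ) (u : EuclideanSpace ℝ (Fin N) → ℝ) : ℝ≥0∞ :=
  ∫⁻ y, ∫⁻ x, ‖u x - u y‖ₑ * kern s (x - y)

/-- The Hardy integral `∫_Ω |u| d_Ω^{-s}`. -/
noncomputable def hardyL1 (s : ℝ) (Ω : Set (EuclideanSpace ℝ (Fin N)))
    (u : EuclideanSpace ℝ (Fin N) → ℝ) : ℝ≥0∞ :=
  ∫⁻ x in Ω, ‖u x‖ₑ * ENNReal.ofReal (bdryDist Ω x ^ s)⁻¹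

theorem kern_neg (s : ℝ) (z : EuclideanSpace ℝ (Fin N)) : kern s (-z) = kern s z := by
  simp [kern]

theorem kern_sub_comm (s : ℝ) (x y : EuclideanSpace ℝ (Fin N)) :
    kern s (x - y) = kern s (y - x) := by
  rw [← kern_neg, neg_sub]

@[fun_prop]
theorem measurable_kern (s : ℝ) : Measurable (kern (N := N) s) := by
  unfold kern; fun_prop

theorem fracSeminorm_one (s : ℝ) (u : EuclideanSpace ℝ (Fin N) → ℝ) :
    fracSeminorm s 1 univ u ^ (1 : ℝ) = energy s u := by
  simp only [fracSeminorm, energy, kern, Measure.restrict_univ, div_one, ENNReal.rpow_one,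
    Real.rpow_one, mul_one]
  refine lintegral_congr fun y => lintegral_congr fun x => ?_
  rw [div_eq_mul_inv, ENNReal.ofReal_mul (abs_nonneg _), Real.enorm_eq_ofReal_abs]

theorem hardyIntegral_one (s : ℝ) (Ω : Set (EuclideanSpace ℝ (Fin N)))
    (u : EuclideanSpace ℝ (Fin N) → ℝ) : hardyIntegral s 1 Ω u = hardyL1 s Ω u := by
  simp only [hardyIntegral, hardyL1, Real.rpow_one, mul_one]
  refine lintegral_congr fun x => ?_
  rw [div_eq_mul_inv, ENNReal.ofReal_mul (abs_nonneg _), Real.enorm_eq_ofReal_abs]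

theorem le_hardyConst {s : ℝ} {Ω : Set (EuclideanSpace ℝ (Fin N))} {c : ℝ≥0∞}
    (h : ∀ u ∈ testFunctions Ω, c * hardyL1 s Ω u ≤ energy s u) : c ≤ hardyConst s 1 Ω := by
  refine le_sInf ?_
  rintro _ ⟨u, hu, h1, rfl⟩
  rw [fracSeminorm_one]
  rw [hardyIntegral_one] at h1
  simpa [h1] using h u hu

theorem energy_const_mul (s c : ℝ) (u : EuclideanSpace ℝ (Fin N) → ℝ) :
    energy s (fun x => c * u x) = ‖c‖ₑ * energy s u := by
  simp only [energy, ← mul_sub, enorm_mul, mul_assoc]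
  simp_rw [lintegral_const_mul' _ _ enorm_ne_top]

theorem hardyL1_const_mul (s c : ℝ) (Ω : Set (EuclideanSpace ℝ (Fin N)))
    (u : EuclideanSpace ℝ (Fin N) → ℝ) :
    hardyL1 s Ω (fun x => c * u x) = ‖c‖ₑ * hardyL1 s Ω u := by
  simp only [hardyL1, enorm_mul, mul_assoc]
  rw [lintegral_const_mul' _ _ enorm_ne_top]

theorem bdryDist_pos {Ω : Set (EuclideanSpace ℝ (Fin N))} (hΩ : IsOpen Ω)
    (hne : (frontier Ω).Nonempty) {x : EuclideanSpace ℝ (Fin N)} (hx : x ∈ Ω) :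
    0 < bdryDist Ω x := by
  rw [bdryDist, ← isClosed_frontier.notMem_iff_infDist_pos hne]
  exact fun h => (disjoint_frontier_iff_isOpen.2 hΩ).le_bot ⟨h, hx⟩

/-- The weight is continuous on the compact support of `u`, which stays away from the boundary.
Finiteness is what permits normalising `u` in `hardyConst_mul_le`. -/
theorem hardyL1_ne_top (s : ℝ) {Ω : Set (EuclideanSpace ℝ (Fin N))} (hΩ : IsOpen Ω)
    (hne : (frontier Ω).Nonempty) {u : EuclideanSpace ℝ (Fin N) → ℝ}
    (hu : u ∈ testFunctions Ω) : hardyL1 s Ω u ≠ ⊤ := by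
  obtain ⟨hsm, hc, hsub⟩ := hu
  have hcont : ContinuousOn (fun x => u x * (bdryDist Ω x ^ s)⁻¹) (tsupport u) := by
    refine hsm.continuous.continuousOn.mul (ContinuousOn.inv₀ ?_ ?_)
    · refine (Metric.continuous_infDist_pt _).continuousOn.rpow_const fun x hx => Or.inl ?_
      exact (bdryDist_pos hΩ hne (hsub hx)).ne'
    · intro x hx
      exact (Real.rpow_pos_of_pos (bdryDist_pos hΩ hne (hsub hx)) s).ne'
  have hint := hcont.integrableOn_compact (μ := volume) hc
  have h2 : hardyL1 s Ω u = ∫⁻ x in tsupport u, ‖u x * (bdryDist Ω x ^ s)⁻¹‖ₑ := by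
    rw [hardyL1, ← lintegral_indicator hΩ.measurableSet,
      ← lintegral_indicator (isClosed_tsupport u).measurableSet]
    refine lintegral_congr fun x => ?_
    by_cases hx : x ∈ tsupport u
    · have hd := bdryDist_pos hΩ hne (hsub hx)
      rw [indicator_of_mem (hsub hx), indicator_of_mem hx, enorm_mul,
        Real.enorm_eq_ofReal (r := (bdryDist Ω x ^ s)⁻¹) (by positivity)]
    · rw [indicator_of_notMem hx]
      by_cases hx' : x ∈ Ω
      · rw [indicator_of_mem hx', image_eq_zero_of_notMem_tsupport hx]; simp
      · rw [indicator_of_notMem hx']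
  rw [h2]
  exact hint.2.ne

theorem hardyConst_mul_le {s : ℝ} {Ω : Set (EuclideanSpace ℝ (Fin N))} (hΩ : IsOpen Ω)
    (hne : (frontier Ω).Nonempty) {u : EuclideanSpace ℝ (Fin N) → ℝ}
    (hu : u ∈ testFunctions Ω) : hardyConst s 1 Ω * hardyL1 s Ω u ≤ energy s u := by
  set I := hardyL1 s Ω u with hI
  have hI2 : I ≠ ⊤ := hardyL1_ne_top s hΩ hne hu
  by_cases hI0 : I = 0
  · simp [hI0]
  have hpos : 0 < I.toReal := ENNReal.toReal_pos hI0 hI2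
  have he : ‖I.toReal⁻¹‖ₑ = I⁻¹ := by
    rw [Real.enorm_eq_ofReal (by positivity), ENNReal.ofReal_inv_of_pos hpos,
      ENNReal.ofReal_toReal hI2]
  have h : hardyConst s 1 Ω ≤ I⁻¹ * energy s u := by
    refine sInf_le ⟨fun x => I.toReal⁻¹ * u x, ⟨contDiff_const.mul hu.1, hu.2.1.mul_left,
      (tsupport_mul_subset_right).trans hu.2.2⟩, ?_, ?_⟩
    · rw [hardyIntegral_one, hardyL1_const_mul, he, ← hI, ENNReal.inv_mul_cancel hI0 hI2]
    · rw [fracSeminorm_one, energy_const_mul, he]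
  calc _ ≤ I⁻¹ * energy s u * I := by gcongr
    _ = energy s u := by
      rw [mul_comm, ← mul_assoc, ENNReal.mul_inv_cancel hI0 hI2, one_mul]

end Energy

/-! ### Splitting off the first coordinate of `ℝ^{n+1}`. -/

/-- The point `(t, z)` of `ℝ^{n+1}`. -/
def consE {n : ℕ} (t : ℝ) (z : EuclideanSpace ℝ (Fin n)) : EuclideanSpace ℝ (Fin (n + 1)) :=
  WithLp.toLp 2 (Fin.cons t z.ofLp)

/-- The last `n` coordinates of a point of `ℝ^{n+1}`. -/
def tailE {n : ℕ} (x : EuclideanSpace ℝ (Fin (n + 1))) : EuclideanSpace ℝ (Fin n) :=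
  WithLp.toLp 2 (fun i => x i.succ)

section Cons

variable {n : ℕ}

@[simp] theorem consE_zero (t : ℝ) (z : EuclideanSpace ℝ (Fin n)) : consE t z 0 = t := rfl

@[simp] theorem consE_succ (t : ℝ) (z : EuclideanSpace ℝ (Fin n)) (i : Fin n) :
    consE t z i.succ = z i := rfl

@[simp] theorem tailE_consE (t : ℝ) (z : EuclideanSpace ℝ (Fin n)) : tailE (consE t z) = z := rfl

@[simp] theorem consE_tailE (x : EuclideanSpace ℝ (Fin (n + 1))) : consE (x 0) (tailE x) = x := by
  ext i
  refine Fin.cases ?_ (fun i => ?_) i <;> rfl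

theorem norm_consE_sq (t : ℝ) (z : EuclideanSpace ℝ (Fin n)) :
    ‖consE t z‖ ^ 2 = t ^ 2 + ‖z‖ ^ 2 := by
  rw [EuclideanSpace.real_norm_sq_eq, EuclideanSpace.real_norm_sq_eq, Fin.sum_univ_succ]
  simp

theorem lintegral_consE {f : EuclideanSpace ℝ (Fin (n + 1)) → ℝ≥0∞} (hf : Measurable f) :
    ∫⁻ x, f x = ∫⁻ t : ℝ, ∫⁻ z : EuclideanSpace ℝ (Fin n), f (consE t z) := by
  rw [← (PiLp.volume_preserving_toLp (Fin (n + 1))).lintegral_comp hf,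
    ← (volume_preserving_piFinSuccAbove (fun _ : Fin (n + 1) => ℝ) 0).symm.lintegral_comp
      (by fun_prop), Measure.volume_eq_prod, lintegral_prod _ (by fun_prop)]
  refine lintegral_congr fun t => ?_
  rw [← (PiLp.volume_preserving_ofLp (Fin n)).lintegral_comp (by fun_prop)]
  refine lintegral_congr fun z => ?_
  simp [consE, MeasurableEquiv.piFinSuccAbove_symm_apply, Fin.insertNthEquiv]

@[fun_prop]
theorem measurable_consE : Measurable fun p : ℝ × EuclideanSpace ℝ (Fin n) => consE p.1 p.2 := by
  unfold consE
  refine (WithLp.measurable_toLp 2 _).comp (measurable_pi_lambda _ fun i => ?_)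
  refine Fin.cases ?_ (fun i => ?_) i
  · exact measurable_fst
  · simp only [Fin.cons_succ]; fun_prop

@[fun_prop]
theorem measurable_tailE : Measurable (tailE (n := n)) := by
  unfold tailE; fun_prop

end Cons

/-! ### The constants `C_{N,s}` and `Λ_{s,1}`, and the reduction of the kernel to one variable. -/

section Constants

variable {n : ℕ} {s : ℝ}

theorem lintegral_comp_smul_of_pos {E : Type*} [NormedAddCommGroup E] [NormedSpace ℝ E]
    [FiniteDimensional ℝ E] [MeasurableSpace E] [BorelSpace E] (μ : Measure E)
    [μ.IsAddHaarMeasure] {f : E → ℝ≥0∞} (hf : Measurable f) {r : ℝ} (hr : 0 < r) :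
    ∫⁻ x, f x ∂μ = ENNReal.ofReal (r ^ Module.finrank ℝ E) * ∫⁻ x, f (r • x) ∂μ := by
  rw [← lintegral_map (f := f) (g := fun x => r • x) hf (measurable_const_smul r),
    Measure.map_addHaar_smul μ hr.ne', lintegral_smul_measure, smul_eq_mul, ← mul_assoc,
    ← ENNReal.ofReal_mul (by positivity), abs_of_pos (by positivity), mul_inv_cancel₀ (by positivity),
    ENNReal.ofReal_one, one_mul]

/-- Polar coordinates in `ℝ^n`. For `n = 0` the volume is a Dirac mass and the integral is `1`, so
this form treats dimension one together with the others. -/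
theorem constC_succ (hs0 : 0 < s) : constC (n + 1) s =
    ∫⁻ z : EuclideanSpace ℝ (Fin n),
      ENNReal.ofReal ((1 + ‖z‖ ^ 2) ^ (-(((n + 1 : ℕ) : ℝ) + s) / 2)) := by
  rcases Nat.eq_zero_or_pos n with rfl | hn
  · have : ∀ z : EuclideanSpace ℝ (Fin 0), ‖z‖ = 0 := fun z => by
      rw [Subsingleton.elim z 0, norm_zero]
    simp only [constC, this]
    simp only [zero_add, if_true]
    rw [volume_euclideanSpace_eq_dirac]
    simp
  · have hne : n + 1 ≠ 1 := by omega
    have : Nonempty (Fin n) := ⟨⟨0, hn⟩⟩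
    simp only [constC, if_neg hne]
    change ((n : ℕ) : ℝ≥0∞) * volume (Metric.ball (0 : EuclideanSpace ℝ (Fin n)) 1) *
      ∫⁻ t in Set.Ioi (0 : ℝ),
        ENNReal.ofReal (t ^ (n - 1) / (1 + t ^ 2) ^ ((((n + 1 : ℕ) : ℝ) + s) / 2)) = _
    set f : ℝ → ℝ := fun y => (1 + y ^ 2) ^ (-(((n + 1 : ℕ) : ℝ) + s) / 2) with hf
    have hint : Integrable (fun z : EuclideanSpace ℝ (Fin n) => f ‖z‖) :=
      integrable_rpow_neg_one_add_norm_sq (by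
        rw [finrank_euclideanSpace_fin]; push_cast; linarith)
    have hint2 := (integrable_fun_norm_addHaar (volume : Measure (EuclideanSpace ℝ (Fin n)))).1 hint
    rw [finrank_euclideanSpace_fin] at hint2
    have hpos : ∀ y, 0 ≤ f y := fun y => by simp only [hf]; positivity
    change _ = ∫⁻ z, ENNReal.ofReal (f ‖z‖)
    rw [← ofReal_integral_eq_lintegral_ofReal hint (ae_of_all _ fun z => hpos _),
      integral_fun_norm_addHaar, finrank_euclideanSpace_fin, nsmul_eq_mul, smul_eq_mul,
      ENNReal.ofReal_mul (by positivity), ENNReal.ofReal_mul (by positivity),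
      ENNReal.ofReal_natCast, measureReal_def, ENNReal.ofReal_toReal measure_ball_lt_top.ne,
      ofReal_integral_eq_lintegral_ofReal hint2, mul_assoc]
    · congr 2
      refine lintegral_congr fun t => ?_
      rw [smul_eq_mul, div_eq_mul_inv, ← Real.rpow_neg (by positivity), ← neg_div]
    · filter_upwards [ae_restrict_mem measurableSet_Ioi] with y hy
      exact mul_nonneg (pow_nonneg (le_of_lt hy) _) (hpos _)

theorem constC_succ_ne_top (hs0 : 0 < s) : constC (n + 1) s ≠ ⊤ := by
  rw [constC_succ hs0]
  have hint : Integrable (fun z : EuclideanSpace ℝ (Fin n) =>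
      ((1 : ℝ) + ‖z‖ ^ 2) ^ (-(((n + 1 : ℕ) : ℝ) + s) / 2)) :=
    integrable_rpow_neg_one_add_norm_sq (by
      rw [finrank_euclideanSpace_fin]; push_cast; linarith)
  exact hint.lintegral_lt_top.ne

/-- Substitute `z = |t| z'`: the Jacobian `|t|^n` and the factor `|t|^{-(n+1+s)}` from the kernel
combine to `|t|^{-(1+s)}`. -/
theorem lintegral_kern_consE (hs0 : 0 < s) {t : ℝ} (ht : t ≠ 0) :
    ∫⁻ z : EuclideanSpace ℝ (Fin n), kern s (consE t z) =
      constC (n + 1) s * ENNReal.ofReal (|t| ^ (-(1 + s))) := by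
  have ht' : 0 < |t| := abs_pos.2 ht
  have hcons : Measurable fun z : EuclideanSpace ℝ (Fin n) => consE t z :=
    measurable_consE.comp (measurable_const.prodMk measurable_id)
  have hk : Measurable fun z : EuclideanSpace ℝ (Fin n) => kern s (consE t z) :=
    (measurable_kern s).comp hcons
  rw [lintegral_comp_smul_of_pos volume hk ht', constC_succ hs0,
    ← lintegral_const_mul' _ _ ENNReal.ofReal_ne_top, mul_comm,
    ← lintegral_const_mul' _ _ ENNReal.ofReal_ne_top]
  refine lintegral_congr fun z => ?_
  have h1 : ‖consE t (|t| • z)‖ = |t| * (1 + ‖z‖ ^ 2) ^ ((1 : ℝ) / 2) := by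
    rw [← Real.sqrt_eq_rpow, ← Real.sqrt_sq (norm_nonneg _), norm_consE_sq, norm_smul,
      Real.norm_eq_abs, abs_abs, ← Real.sqrt_sq ht'.le, ← Real.sqrt_mul (sq_nonneg _),
      Real.sqrt_sq ht'.le, mul_pow, sq_abs]
    ring_nf
  rw [kern, h1, finrank_euclideanSpace_fin, ← ENNReal.ofReal_mul (by positivity),
    ← ENNReal.ofReal_mul (by positivity), Real.mul_rpow ht'.le (by positivity), mul_inv,
    ← Real.rpow_mul (by positivity), ← Real.rpow_neg ht'.le, ← Real.rpow_neg (by positivity),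
    ← mul_assoc, ← Real.rpow_natCast, ← Real.rpow_add ht']
  push_cast
  congr 3 <;> ring

theorem lintegral_mul_kern (hs0 : 0 < s) {g : ℝ → ℝ≥0∞} (hg : Measurable g)
    (x : EuclideanSpace ℝ (Fin (n + 1))) :
    ∫⁻ y : EuclideanSpace ℝ (Fin (n + 1)), g (y 0) * kern s (y - x) =
      constC (n + 1) s * ∫⁻ t, g t * ENNReal.ofReal (|t - x 0| ^ (-(1 + s))) := by
  rw [← lintegral_add_right_eq_self _ x, lintegral_consE (by fun_prop),
    ← lintegral_add_right_eq_self (fun t => g t * _) (x 0), ← lintegral_const_mul' _ _ (constC_succ_ne_top hs0)]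
  refine lintegral_congr_ae ?_
  filter_upwards [compl_mem_ae_iff.2 (measure_singleton (0 : ℝ))] with t ht
  simp only [add_sub_cancel_right, PiLp.add_apply, consE_zero]
  have hcons : Measurable fun z : EuclideanSpace ℝ (Fin n) => consE t z :=
    measurable_consE.comp (measurable_const.prodMk measurable_id)
  have hk : Measurable fun z : EuclideanSpace ℝ (Fin n) => kern s (consE t z) :=
    (measurable_kern s).comp hcons
  rw [lintegral_const_mul _ hk, lintegral_kern_consE hs0 ht]
  ring

theorem lintegral_Ioi_rpow (hs0 : 0 < s) {a : ℝ} (ha : 0 < a) :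
    ∫⁻ t in Ioi a, ENNReal.ofReal (t ^ (-(1 + s))) = ENNReal.ofReal (a ^ (-s) / s) := by
  have h1 : -(1 + s) < -1 := by linarith
  rw [← ofReal_integral_eq_lintegral_ofReal (integrableOn_Ioi_rpow_of_lt h1 ha),
    integral_Ioi_rpow_of_lt h1 ha]
  · congr 1
    rw [show -(1 + s) + 1 = -s by ring, neg_div_neg_eq]
  · filter_upwards [ae_restrict_mem measurableSet_Ioi] with t ht
    exact Real.rpow_nonneg (ha.le.trans (le_of_lt ht)) _

theorem lintegral_Ioi_abs_sub (hs0 : 0 < s) {a c : ℝ} (ha : c < a) :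
    ∫⁻ t in Ioi a, ENNReal.ofReal (|t - c| ^ (-(1 + s))) = ENNReal.ofReal ((a - c) ^ (-s) / s) := by
  rw [← lintegral_Ioi_rpow hs0 (sub_pos.2 ha), ← lintegral_indicator measurableSet_Ioi,
    ← lintegral_indicator measurableSet_Ioi, ← lintegral_add_right_eq_self _ c]
  refine lintegral_congr fun t => ?_
  by_cases h : a - c < t
  · have h0 : 0 < t := by linarith
    rw [indicator_of_mem (show t + c ∈ Ioi a by simp; linarith), indicator_of_mem (show t ∈ Ioi (a - c) from h),
      add_sub_cancel_right, abs_of_pos h0]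
  · rw [indicator_of_notMem (show t + c ∉ Ioi a by simp; linarith),
      indicator_of_notMem (show t ∉ Ioi (a - c) from h)]

theorem lintegral_Iio_abs_sub (hs0 : 0 < s) {a c : ℝ} (ha : a < c) :
    ∫⁻ t in Iio a, ENNReal.ofReal (|t - c| ^ (-(1 + s))) = ENNReal.ofReal ((c - a) ^ (-s) / s) := by
  have h := lintegral_Ioi_abs_sub hs0 (neg_lt_neg ha)
  rw [neg_sub_neg] at h
  rw [← h, ← lintegral_indicator measurableSet_Ioi, ← lintegral_indicator measurableSet_Iio,
    ← lintegral_neg_eq_self]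
  refine lintegral_congr fun t => ?_
  by_cases h : -a < t
  · rw [indicator_of_mem (show -t ∈ Iio a by simp; linarith), indicator_of_mem (show t ∈ Ioi (-a) from h), abs_sub_comm,
      sub_neg_eq_add, sub_neg_eq_add, add_comm]
  · rw [indicator_of_notMem (show -t ∉ Iio a by simp; linarith),
      indicator_of_notMem (show t ∉ Ioi (-a) from h)]

theorem lintegral_Ioo_rpow_neg (hs1 : s < 1) {a b : ℝ} (ha : 0 ≤ a) (hab : a ≤ b) :
    ∫⁻ t in Ioo a b, ENNReal.ofReal (t ^ (-s)) =
      ENNReal.ofReal ((b ^ (1 - s) - a ^ (1 - s)) / (1 - s)) := by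
  have hint : IntervalIntegrable (fun t : ℝ => t ^ (-s)) volume a b :=
    intervalIntegral.intervalIntegrable_rpow' (by linarith)
  rw [restrict_Ioo_eq_restrict_Ioc, ← ofReal_integral_eq_lintegral_ofReal
    ((intervalIntegrable_iff_integrableOn_Ioc_of_le hab).1 hint),
    ← intervalIntegral.integral_of_le hab, integral_rpow (Or.inl (by linarith)),
    neg_add_eq_sub]
  filter_upwards [ae_restrict_mem measurableSet_Ioc] with t ht
  exact Real.rpow_nonneg (ha.trans ht.1.le) _

theorem constLambda_one (hs0 : 0 < s) (hs1 : s < 1) :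
    constLambda s 1 = ENNReal.ofReal (4 / s) := by
  -- An antiderivative of the integrand, with `F 0 = -1/s` and `F 1 = 0`, so the integral is `1/s`.
  set F : ℝ → ℝ := fun t => (t ^ s - 1) * (1 - t) ^ (-s) / s with hF
  set f : ℝ → ℝ := fun t => |1 - t ^ (s - 1)| / (1 - t) ^ (1 + s) with hf
  have hcont : ContinuousOn F (Icc 0 1) := by
    intro t ht
    rcases eq_or_lt_of_le ht.2 with h1 | h1
    · subst h1
      have hF1 : F 1 = 0 := by simp [hF]
      rw [ContinuousWithinAt, hF1]
      -- Near `1`, `t ≤ t ^ s` gives `|F t| ≤ (1 - t) ^ (1 - s) / s`, which tends to `0` because `s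
      -- < 1`.
      have hg : Tendsto (fun t : ℝ => (1 - t) ^ (1 - s) / s) (𝓝[Icc 0 1] 1) (𝓝 0) := by
        have : ContinuousAt (fun t : ℝ => (1 - t) ^ (1 - s) / s) 1 := by
          refine ContinuousAt.div_const (ContinuousAt.rpow_const (by fun_prop) ?_) s
          right; linarith
        have h2 := this.tendsto
        simp only [sub_self, Real.zero_rpow (show 1 - s ≠ 0 by linarith), zero_div] at h2
        exact h2.mono_left nhdsWithin_le_nhds
      refine squeeze_zero_norm' ?_ hg
      filter_upwards [self_mem_nhdsWithin] with t ht
      rcases eq_or_lt_of_le ht.2 with h1 | h1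
      · subst h1; rw [hF1, norm_zero]
        simp [Real.zero_rpow (show 1 - s ≠ 0 by linarith)]
      have hts : t ≤ t ^ s := by
        simpa using Real.rpow_le_rpow_of_exponent_ge' ht.1 ht.2 hs0.le hs1.le
      have hts1 : t ^ s ≤ 1 := Real.rpow_le_one ht.1 ht.2 hs0.le
      have hp : 0 < 1 - t := by linarith
      have hpp := Real.rpow_pos_of_pos hp (-s)
      rw [hF, Real.norm_eq_abs, abs_div, abs_mul, abs_of_pos hs0, abs_of_pos hpp,
        abs_of_nonpos (by linarith), show 1 - s = 1 + -s by ring, Real.rpow_add hp, Real.rpow_one]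
      gcongr
      linarith
    · refine ContinuousAt.continuousWithinAt ?_
      refine ContinuousAt.div_const (ContinuousAt.mul ?_ ?_) s
      · exact (Real.continuousAt_rpow_const t s (Or.inr hs0.le)).sub continuousAt_const
      · exact ContinuousAt.rpow_const (by fun_prop) (Or.inl (by linarith))
  have hderiv : ∀ t ∈ Ioo (0 : ℝ) 1, HasDerivAt F (f t) t := by
    intro t ht
    have hp : 0 < 1 - t := by linarith [ht.2]
    have h1 := (Real.hasDerivAt_rpow_const (p := s) (Or.inl ht.1.ne')).sub_const 1
    have h2 := ((hasDerivAt_id t).const_sub 1).rpow_const (p := -s) (Or.inl hp.ne')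
    have h3 := (h1.mul h2).div_const s
    refine h3.congr_deriv (Eq.symm ?_)
    have hle : 1 ≤ t ^ (s - 1) := Real.one_le_rpow_of_pos_of_le_one_of_nonpos ht.1 ht.2.le
      (by linarith)
    simp only [hf, id]
    rw [abs_of_nonpos (by linarith), div_eq_mul_inv, ← Real.rpow_neg hp.le,
      show (-s : ℝ) = -(1 + s) + 1 by ring, Real.rpow_add hp, Real.rpow_one,
      show t ^ s = t ^ (s - 1) * t by rw [← Real.rpow_add_one ht.1.ne']; ring_nf,
      show (-(1 + s) + 1 - 1 : ℝ) = -(1 + s) by ring]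
    field_simp
    ring
  have hpos : ∀ t ∈ Ioo (0 : ℝ) 1, 0 ≤ f t := fun t ht =>
    div_nonneg (abs_nonneg _) (Real.rpow_nonneg (by linarith [ht.2]) _)
  have hint := intervalIntegral.integrableOn_deriv_of_nonneg hcont hderiv hpos
  have hval : ∫ t in (0 : ℝ)..1, f t = 1 / s := by
    rw [intervalIntegral.integral_eq_sub_of_hasDerivAt_of_le zero_le_one hcont hderiv
      ((intervalIntegrable_iff_integrableOn_Ioc_of_le zero_le_one).2 hint)]
    simp [hF, Real.zero_rpow hs0.ne']
    ring
  have hl : ∫⁻ t in Ioo (0 : ℝ) 1, ENNReal.ofReal (f t) = ENNReal.ofReal (1 / s) := by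
    rw [← hval, intervalIntegral.integral_of_le zero_le_one, restrict_Ioo_eq_restrict_Ioc,
      ofReal_integral_eq_lintegral_ofReal hint]
    rw [← restrict_Ioo_eq_restrict_Ioc]
    filter_upwards [ae_restrict_mem measurableSet_Ioo] with t ht using hpos t ht
  simp only [constLambda, mul_one, div_one, Real.rpow_one]
  rw [hl, ← ENNReal.ofReal_ofNat 2, ← ENNReal.ofReal_mul (by norm_num),
    ← ENNReal.ofReal_add (by positivity) (by positivity)]
  congr 1
  ring

/-- In polar coordinates the integrand is at most `L r^{-s}` near `0`, integrable as `s < 1`, and at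
most `r^{-(1+s)}` at infinity, integrable as `s > 0`. -/
theorem lintegral_min_mul_kern_ne_top (hs0 : 0 < s) (hs1 : s < 1) {L : ℝ} (hL : 0 ≤ L) :
    ∫⁻ z : EuclideanSpace ℝ (Fin (n + 1)), ENNReal.ofReal (min 1 (L * ‖z‖)) * kern s z ≠ ⊤ := by
  set f : ℝ → ℝ := fun y => min 1 (L * y) * (y ^ (((n + 1 : ℕ) : ℝ) + s))⁻¹ with hf
  have hfm : Measurable f := by rw [hf]; fun_prop
  have hint : Integrable (fun z : EuclideanSpace ℝ (Fin (n + 1)) => f ‖z‖) := by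
    rw [integrable_fun_norm_addHaar, finrank_euclideanSpace_fin, ← Ioc_union_Ioi_eq_Ioi zero_le_one]
    have key : ∀ y : ℝ, 0 < y → y ^ (n + 1 - 1) • f y = min 1 (L * y) * y ^ (-(1 + s)) := by
      intro y hy
      simp only [hf]
      rw [smul_eq_mul, ← Real.rpow_neg hy.le, mul_left_comm, Nat.add_sub_cancel,
        ← Real.rpow_natCast, ← Real.rpow_add hy]
      push_cast
      ring_nf
    have hmeas : Measurable fun y : ℝ => y ^ (n + 1 - 1) • f y := by
      simp only [smul_eq_mul]; fun_prop
    refine IntegrableOn.union ?_ ?_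
    · have h0 : IntegrableOn (fun t : ℝ => L * t ^ (-s)) (Ioc 0 1) :=
        ((intervalIntegrable_iff_integrableOn_Ioc_of_le zero_le_one).1
          (intervalIntegral.intervalIntegrable_rpow' (by linarith))).const_mul L
      refine h0.mono' hmeas.aestronglyMeasurable ?_
      filter_upwards [ae_restrict_mem measurableSet_Ioc] with y hy
      have hy0 : 0 < y := hy.1
      rw [key y hy.1, Real.norm_of_nonneg (by positivity)]
      calc _ ≤ (L * y) * y ^ (-(1 + s)) := by gcongr; exact min_le_right _ _
        _ = L * y ^ (-s) := by
          rw [mul_assoc, ← Real.rpow_one_add' hy0.le (by linarith)]; ring_nf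
    · refine (integrableOn_Ioi_rpow_of_lt (show -(1 + s) < -1 by linarith) zero_lt_one).mono'
        hmeas.aestronglyMeasurable ?_
      filter_upwards [ae_restrict_mem measurableSet_Ioi] with y hy
      have hy0 : 0 < y := zero_lt_one.trans hy
      rw [key y hy0, Real.norm_of_nonneg (by positivity)]
      exact mul_le_of_le_one_left (by positivity) (min_le_left _ _)
  have h2 := hint.lintegral_lt_top.ne
  convert h2 using 3 with z
  rw [hf, ENNReal.ofReal_mul (by positivity), kern]

end Constants

/-! ### Boundary distance, supporting hyperplanes and the half-space. -/

section Geometry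

variable {N : ℕ}

/-- The ball is connected and misses the frontier, so it is covered by the disjoint open sets `Ω`
and the complement of `closure Ω`. -/
theorem ball_bdryDist_subset {Ω : Set (EuclideanSpace ℝ (Fin N))} (hΩ : IsOpen Ω)
    {x : EuclideanSpace ℝ (Fin N)} (hx : x ∈ Ω) : Metric.ball x (bdryDist Ω x) ⊆ Ω := by
  rcases le_or_gt (bdryDist Ω x) 0 with h | h
  · rw [Metric.ball_eq_empty.2 h]; exact empty_subset _
  refine IsPreconnected.subset_left_of_subset_union hΩ isClosed_closure.isOpen_compl
    (disjoint_compl_right.mono_left subset_closure |>.mono_right subset_rfl) ?_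
    ⟨x, Metric.mem_ball_self h, hx⟩ (convex_ball x _).isPreconnected
  intro y hy
  by_cases hyc : y ∈ closure Ω
  · left
    by_contra hyΩ
    have hyf : y ∈ frontier Ω := by rw [hΩ.frontier_eq]; exact ⟨hyc, hyΩ⟩
    have := Metric.infDist_le_dist_of_mem hyf (x := x)
    rw [Metric.mem_ball, dist_comm] at hy
    exact absurd hy (not_lt.2 this)
  · exact Or.inr hyc

theorem bdryDist_le_dist {Ω : Set (EuclideanSpace ℝ (Fin N))} (hΩ : IsOpen Ω)
    {x p : EuclideanSpace ℝ (Fin N)} (hx : x ∈ Ω) (hp : p ∉ Ω) : bdryDist Ω x ≤ dist x p := by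
  by_contra! h
  exact hp (ball_bdryDist_subset hΩ hx (by rwa [Metric.mem_ball, dist_comm]))

/-- A point outside a convex open set is separated from it by a hyperplane with unit normal. -/
theorem exists_unit_normal {Ω : Set (EuclideanSpace ℝ (Fin N))} (hΩ : IsOpen Ω)
    (hconv : Convex ℝ Ω) (hne : Ω.Nonempty) {z : EuclideanSpace ℝ (Fin N)} (hz : z ∉ Ω) :
    ∃ ν : EuclideanSpace ℝ (Fin N), ‖ν‖ = 1 ∧ ∀ y ∈ Ω, ⟪ν, y - z⟫_ℝ < 0 := by
  obtain ⟨f, hf⟩ := geometric_hahn_banach_open_point hconv hΩ hz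
  set w := (InnerProductSpace.toDual ℝ (EuclideanSpace ℝ (Fin N))).symm f with hw
  have hfw : ∀ y, f y = ⟪w, y⟫_ℝ := fun y => by
    rw [hw, InnerProductSpace.toDual_symm_apply]
  have hw0 : w ≠ 0 := by
    rintro h0
    obtain ⟨y, hy⟩ := hne
    have := hf y hy
    rw [hfw, hfw, h0] at this
    simp at this
  refine ⟨‖w‖⁻¹ • w, norm_smul_inv_norm hw0, fun y hy => ?_⟩
  have := hf y hy
  rw [hfw, hfw] at this
  rw [real_inner_smul_left, inner_sub_right]
  exact mul_neg_of_pos_of_neg (inv_pos.2 (norm_pos_iff.2 hw0)) (by linarith)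

/-- The orthogonal projection of `y` onto the separating hyperplane is not in `Ω`. -/
theorem bdryDist_le_of_normal {Ω : Set (EuclideanSpace ℝ (Fin N))} (hΩ : IsOpen Ω)
    {ν z : EuclideanSpace ℝ (Fin N)} (hν : ‖ν‖ = 1) (h : ∀ y ∈ Ω, ⟪ν, y - z⟫_ℝ < 0)
    {y : EuclideanSpace ℝ (Fin N)} (hy : y ∈ Ω) : bdryDist Ω y ≤ -⟪ν, y - z⟫_ℝ := by
  set a := -⟪ν, y - z⟫_ℝ with ha
  have hp : y + a • ν ∉ Ω := by
    intro hp
    have := h _ hp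
    rw [add_sub_right_comm, inner_add_right, real_inner_smul_right, real_inner_self_eq_norm_sq,
      hν] at this
    linarith
  refine (bdryDist_le_dist hΩ hy hp).trans ?_
  rw [dist_self_add_right, norm_smul, hν, mul_one, Real.norm_of_nonneg]
  have := h y hy
  linarith

theorem isOpen_halfSpace [NeZero N] : IsOpen (halfSpace N) :=
  isOpen_lt continuous_const (EuclideanSpace.proj (𝕜 := ℝ) (0 : Fin N)).continuous

theorem frontier_halfSpace_nonempty [NeZero N] : (frontier (halfSpace N)).Nonempty := by
  rw [nonempty_frontier_iff]
  refine ⟨⟨EuclideanSpace.single 0 1, by simp [halfSpace]⟩, fun h => ?_⟩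
  have : (0 : EuclideanSpace ℝ (Fin N)) ∈ halfSpace N := h ▸ mem_univ _
  simp [halfSpace] at this

theorem bdryDist_halfSpace [NeZero N] {x : EuclideanSpace ℝ (Fin N)} (hx : x ∈ halfSpace N) :
    bdryDist (halfSpace N) x = x 0 := by
  have hx0 : 0 < x 0 := hx
  apply le_antisymm
  · have := bdryDist_le_of_normal (ν := -EuclideanSpace.single 0 1) (z := 0) isOpen_halfSpace
      (by simp)
      (by intro y hy; simpa [EuclideanSpace.inner_single_left, halfSpace] using hy) hx
    simpa [EuclideanSpace.inner_single_left] using this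
  · refine (Metric.le_infDist frontier_halfSpace_nonempty).2 fun y hy => ?_
    have hy0 : y ∉ halfSpace N := fun h =>
      (disjoint_frontier_iff_isOpen.2 isOpen_halfSpace).le_bot ⟨hy, h⟩
    have hy0 : y 0 ≤ 0 := not_lt.1 hy0
    have h1 : ‖(x - y) 0‖ ≤ ‖x - y‖ := PiLp.norm_apply_le _ _
    rw [dist_eq_norm]
    refine le_trans ?_ h1
    rw [PiLp.sub_apply, Real.norm_eq_abs]
    exact le_trans (by linarith) (le_abs_self _)

/-- The reflection exchanging the first basis vector and `ν`. -/
theorem exists_isometry_inner_eq [NeZero N] {ν : EuclideanSpace ℝ (Fin N)} (hν : ‖ν‖ = 1) :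
    ∃ T : EuclideanSpace ℝ (Fin N) ≃ₗᵢ[ℝ] EuclideanSpace ℝ (Fin N), ∀ x, ⟪ν, T x⟫_ℝ = x 0 := by
  set e : EuclideanSpace ℝ (Fin N) := EuclideanSpace.single 0 1
  have he : ‖e‖ = ‖ν‖ := by simp [e, hν]
  set T := Submodule.reflection (ℝ ∙ (e - ν))ᗮ with hT
  have hTe : T e = ν := Submodule.reflection_sub he
  refine ⟨T, fun x => ?_⟩
  rw [← hTe, LinearIsometryEquiv.inner_map_map]
  simp [e, EuclideanSpace.inner_single_left]

end Geometry

/-! ### Lower bounds for the Hardy constant. -/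

/-- The integrand is symmetric in `x` and `y`, so a weight that selects each unordered pair at most
once may be counted twice. -/
theorem two_mul_lintegral_le_energy {N : ℕ} (s : ℝ) {u : EuclideanSpace ℝ (Fin N) → ℝ}
    (hu : Measurable u) {m : EuclideanSpace ℝ (Fin N) → EuclideanSpace ℝ (Fin N) → ℝ≥0∞}
    (hm : Measurable (Function.uncurry m)) (h : ∀ x y, m x y + m y x ≤ 1) :
    2 * ∫⁻ y, ∫⁻ x, m x y * (‖u x - u y‖ₑ * kern s (x - y)) ≤ energy s u := by
  have hm' : Measurable fun p : EuclideanSpace ℝ (Fin N) × EuclideanSpace ℝ (Fin N) =>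
    m p.1 p.2 := hm
  have hm2 : Measurable fun p : EuclideanSpace ℝ (Fin N) × EuclideanSpace ℝ (Fin N) =>
    m p.2 p.1 := hm'.comp measurable_swap
  have hF : Measurable fun p : EuclideanSpace ℝ (Fin N) × EuclideanSpace ℝ (Fin N) =>
      m p.2 p.1 * (‖u p.2 - u p.1‖ₑ * kern s (p.2 - p.1)) := by fun_prop
  have hG : Measurable fun p : EuclideanSpace ℝ (Fin N) × EuclideanSpace ℝ (Fin N) =>
      m p.1 p.2 * (‖u p.2 - u p.1‖ₑ * kern s (p.2 - p.1)) := by fun_prop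
  have hswap : ∫⁻ y, ∫⁻ x, m x y * (‖u x - u y‖ₑ * kern s (x - y)) =
      ∫⁻ y, ∫⁻ x, m y x * (‖u x - u y‖ₑ * kern s (x - y)) := by
    rw [lintegral_lintegral_swap (f := fun y x => m x y * (‖u x - u y‖ₑ * kern s (x - y)))
      hF.aemeasurable]
    refine lintegral_congr fun x => lintegral_congr fun y => ?_
    rw [kern_sub_comm, ← enorm_neg, neg_sub]
  rw [two_mul]
  nth_rewrite 2 [hswap]
  rw [← lintegral_add_left hF.lintegral_prod_right']
  refine lintegral_mono fun y => ?_
  have hFy : Measurable fun x => m x y * (‖u x - u y‖ₑ * kern s (x - y)) :=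
    hF.comp measurable_prodMk_left
  simp only
  rw [← lintegral_add_left hFy]
  refine lintegral_mono fun x => ?_
  rw [← add_mul]
  exact mul_le_of_le_one_left' (h x y)

section LowerBounds

variable {n : ℕ} {s : ℝ}

theorem lintegral_kern_halfSpace (hs0 : 0 < s) {ν : EuclideanSpace ℝ (Fin (n + 1))} (hν : ‖ν‖ = 1)
    (y : EuclideanSpace ℝ (Fin (n + 1))) {a : ℝ} (ha : 0 < a) :
    ∫⁻ x in {x | a < ⟪ν, x - y⟫_ℝ}, kern s (x - y) =
      constC (n + 1) s * ENNReal.ofReal (a ^ (-s) / s) := by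
  obtain ⟨T, hT⟩ := exists_isometry_inner_eq hν
  have hset : MeasurableSet {x : EuclideanSpace ℝ (Fin (n + 1)) | a < ⟪ν, x - y⟫_ℝ} :=
    (isOpen_lt continuous_const (by fun_prop)).measurableSet
  have hg : Measurable ((Ioi a).indicator fun _ => (1 : ℝ≥0∞)) :=
    measurable_const.indicator measurableSet_Ioi
  have h := lintegral_mul_kern hs0 hg (0 : EuclideanSpace ℝ (Fin (n + 1)))
  rw [← lintegral_indicator hset, ← lintegral_add_right_eq_self _ y,
    ← T.measurePreserving.lintegral_comp_emb T.toHomeomorph.measurableEmbedding]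
  have h2 : ∫⁻ t, (Ioi a).indicator (fun _ => (1 : ℝ≥0∞)) t * ENNReal.ofReal (|t - 0| ^ (-(1 + s)))
      = ENNReal.ofReal (a ^ (-s) / s) := by
    have := lintegral_Ioi_abs_sub hs0 ha
    rw [sub_zero, ← lintegral_indicator measurableSet_Ioi] at this
    rw [← this]
    refine lintegral_congr fun t => ?_
    by_cases ht : t ∈ Ioi a <;> simp [ht]
  rw [PiLp.zero_apply, h2] at h
  rw [← h]
  refine lintegral_congr fun x => ?_
  have hk : kern s (T x) = kern s x := by simp [kern]
  by_cases hx : a < x 0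
  · rw [indicator_of_mem (show T x + y ∈ {x | a < ⟪ν, x - y⟫_ℝ} by simpa [hT] using hx),
      indicator_of_mem (show x 0 ∈ Ioi a from hx)]
    simp [hk]
  · rw [indicator_of_notMem (show T x + y ∉ {x | a < ⟪ν, x - y⟫_ℝ} by simpa [hT] using hx),
      indicator_of_notMem (show x 0 ∉ Ioi a from hx)]
    simp

/-- The hyperplane separating `Ω` from a nearest boundary point lies at distance `a ≤ d_Ω(y)` from
`y`, and everything beyond it is outside `Ω`. -/
theorem le_lintegral_kern_compl (hs0 : 0 < s) {Ω : Set (EuclideanSpace ℝ (Fin (n + 1)))}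
    (hΩ : IsOpen Ω) (hconv : Convex ℝ Ω) (hfr : (frontier Ω).Nonempty)
    {y : EuclideanSpace ℝ (Fin (n + 1))} (hy : y ∈ Ω) :
    constC (n + 1) s * ENNReal.ofReal (bdryDist Ω y ^ (-s) / s) ≤
      ∫⁻ x in Ωᶜ, kern s (x - y) := by
  obtain ⟨z, hz, hdz⟩ := isClosed_frontier.exists_infDist_eq_dist hfr y
  have hzΩ : z ∉ Ω := fun h => (disjoint_frontier_iff_isOpen.2 hΩ).le_bot ⟨hz, h⟩
  obtain ⟨ν, hν, hsep⟩ := exists_unit_normal hΩ hconv ⟨y, hy⟩ hzΩ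
  set a := -⟪ν, y - z⟫_ℝ with ha
  have ha0 : 0 < a := by have := hsep y hy; linarith
  have had : a ≤ bdryDist Ω y := by
    rw [bdryDist, hdz, dist_eq_norm]
    have := abs_real_inner_le_norm ν (y - z)
    rw [hν, one_mul] at this
    exact (neg_le_abs _).trans this
  calc _ ≤ constC (n + 1) s * ENNReal.ofReal (a ^ (-s) / s) := by
        gcongr 1
        refine ENNReal.ofReal_le_ofReal (div_le_div_of_nonneg_right ?_ hs0.le)
        exact Real.rpow_le_rpow_of_nonpos ha0 had (by linarith)
    _ = _ := (lintegral_kern_halfSpace hs0 hν y ha0).symm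
    _ ≤ _ := by
      refine lintegral_mono_set fun x hx hxΩ => ?_
      have h1 := hsep x hxΩ
      have h2 : a < ⟪ν, x - y⟫_ℝ := hx
      rw [show x - z = (x - y) + (y - z) by abel, inner_add_right] at h1
      linarith

/-- Only pairs with exactly one point in `Ω` are kept, and there `|u(x) - u(y)| = |u(y)|` for `y ∈
Ω`. The pairs inside `Ω` are discarded. -/
theorem convex_le_hardyConst (hs0 : 0 < s) {Ω : Set (EuclideanSpace ℝ (Fin (n + 1)))}
    (hΩ : IsOpen Ω) (hconv : Convex ℝ Ω) (hfr : (frontier Ω).Nonempty) :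
    ENNReal.ofReal (2 / s) * constC (n + 1) s ≤ hardyConst s 1 Ω := by
  refine le_hardyConst fun u hu => ?_
  have hum : Measurable u := hu.1.continuous.measurable
  set m : EuclideanSpace ℝ (Fin (n + 1)) → EuclideanSpace ℝ (Fin (n + 1)) → ℝ≥0∞ :=
    fun x y => Ωᶜ.indicator 1 x * Ω.indicator 1 y with hmdef
  have hm : Measurable (Function.uncurry m) :=
    ((measurable_one.indicator hΩ.measurableSet.compl).comp measurable_fst).mul
      ((measurable_one.indicator hΩ.measurableSet).comp measurable_snd)
  refine le_trans ?_ (two_mul_lintegral_le_energy s hum hm ?_)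
  · rw [hardyL1, ← lintegral_indicator hΩ.measurableSet, show (2 : ℝ) / s = 2 * (1 / s) by ring,
      ENNReal.ofReal_mul zero_le_two, ENNReal.ofReal_ofNat, mul_assoc, mul_assoc,
      ← lintegral_const_mul' _ _ (constC_succ_ne_top hs0),
      ← lintegral_const_mul' _ _ ENNReal.ofReal_ne_top]
    refine mul_le_mul_right (lintegral_mono fun y => ?_) _
    by_cases hy : y ∈ Ω
    · have hd := bdryDist_pos hΩ hfr hy
      have h1 : ∫⁻ x, m x y * (‖u x - u y‖ₑ * kern s (x - y)) =
          ‖u y‖ₑ * ∫⁻ x in Ωᶜ, kern s (x - y) := by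
        rw [← lintegral_const_mul' _ _ enorm_ne_top, ← lintegral_indicator hΩ.measurableSet.compl]
        refine lintegral_congr fun x => ?_
        by_cases hx : x ∈ Ω
        · simp [m, hx]
        · have hux : u x = 0 := image_eq_zero_of_notMem_tsupport fun h => hx (hu.2.2 h)
          simp [m, hx, hy, hux]
      simp only [h1, indicator_of_mem hy]
      refine le_trans (le_of_eq ?_)
        (mul_le_mul_right (le_lintegral_kern_compl hs0 hΩ hconv hfr hy) _)
      rw [Real.rpow_neg hd.le, div_eq_mul_one_div (_⁻¹), ENNReal.ofReal_mul (by positivity)]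
      ring
    · simp [indicator_of_notMem hy]
  · intro x y
    by_cases hx : x ∈ Ω <;> by_cases hy : y ∈ Ω <;> simp [m, hx, hy]

theorem halfSpace_le_hardyConst (hs0 : 0 < s) :
    ENNReal.ofReal (4 / s) * constC (n + 1) s ≤ hardyConst s 1 (halfSpace (n + 1)) := by
  refine le_hardyConst fun u hu => ?_
  have hum : Measurable u := hu.1.continuous.measurable
  have hC := constC_succ_ne_top (n := n) hs0
  have hK := measurable_kern (N := n + 1) s
  obtain ⟨ε, hε, hεu⟩ : ∃ ε > 0, ∀ y, u y ≠ 0 → ε < y 0 := by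
    rcases (tsupport u).eq_empty_or_nonempty with h | h
    · exact ⟨1, one_pos, fun y hy => absurd (subset_tsupport u hy) (by simp [h])⟩
    · obtain ⟨x, hx, hmin⟩ := hu.2.1.exists_isMinOn h
        (EuclideanSpace.proj (𝕜 := ℝ) (0 : Fin (n + 1))).continuous.continuousOn
      have hx0 : 0 < x 0 := hu.2.2 hx
      refine ⟨x 0 / 2, by positivity, fun y hy => ?_⟩
      have h1 : x 0 ≤ y 0 := hmin (subset_tsupport u hy)
      linarith
  -- `p` selects pairs inside the half-space with `x` lower than `y` by more than `ε`; `q` selects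
  -- pairs across the boundary. The gap `ε` keeps the kernel masses finite, and `u` vanishes at
  -- heights up to `ε`.
  set p : EuclideanSpace ℝ (Fin (n + 1)) → EuclideanSpace ℝ (Fin (n + 1)) → ℝ≥0∞ :=
    fun x y => {q : ℝ × ℝ | 0 < q.1 ∧ q.1 + ε < q.2}.indicator 1 (x 0, y 0) with hp
  set q : EuclideanSpace ℝ (Fin (n + 1)) → EuclideanSpace ℝ (Fin (n + 1)) → ℝ≥0∞ :=
    fun x y => {q : ℝ × ℝ | q.1 < 0 ∧ 0 < q.2}.indicator 1 (x 0, y 0) with hq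
  have hpm0 : Measurable ({q : ℝ × ℝ | 0 < q.1 ∧ q.1 + ε < q.2}.indicator (1 : ℝ × ℝ → ℝ≥0∞)) :=
    measurable_one.indicator ((measurableSet_lt measurable_const measurable_fst).inter
      (measurableSet_lt (measurable_fst.add_const ε) measurable_snd))
  have hqm0 : Measurable ({q : ℝ × ℝ | q.1 < 0 ∧ 0 < q.2}.indicator (1 : ℝ × ℝ → ℝ≥0∞)) :=
    measurable_one.indicator ((measurableSet_lt measurable_fst measurable_const).inter
      (measurableSet_lt measurable_const measurable_snd))
  have hpm : Measurable fun z : EuclideanSpace ℝ (Fin (n + 1)) × EuclideanSpace ℝ (Fin (n + 1)) =>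
      p z.2 z.1 := hpm0.comp (by fun_prop)
  have hqm : Measurable fun z : EuclideanSpace ℝ (Fin (n + 1)) × EuclideanSpace ℝ (Fin (n + 1)) =>
      q z.2 z.1 := hqm0.comp (by fun_prop)
  have hm : Measurable (Function.uncurry fun x y => p x y + q x y) :=
    (hpm.comp measurable_swap).add (hqm.comp measurable_swap)
  -- the common lower bound for the two contributions
  set W := ∫⁻ y, ‖u y‖ₑ * (constC (n + 1) s * ENNReal.ofReal (y 0 ^ (-s) / s)) with hW
  have hQ : ∀ y, 0 < y 0 → ∫⁻ x, q x y * kern s (x - y) =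
      constC (n + 1) s * ENNReal.ofReal (y 0 ^ (-s) / s) := by
    intro y hy
    have h1 := lintegral_mul_kern hs0 (g := (Iio 0).indicator 1)
      (measurable_one.indicator measurableSet_Iio) y
    have h2 := lintegral_Iio_abs_sub hs0 hy
    rw [sub_zero, ← lintegral_indicator measurableSet_Iio] at h2
    rw [← h2]
    convert h1 using 3 with x
    · by_cases hx : x 0 < 0 <;> simp [q, hx, hy]
    · funext t
      by_cases ht : t ∈ Iio (0 : ℝ) <;> simp [ht]
  -- The two selections are disjoint and both lie in `x 0 < y 0 - ε`; for the second this uses `ε <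
  -- y 0`.
  have hPQ : ∀ y, ε < y 0 → (∫⁻ x, p x y * kern s (x - y)) + ∫⁻ x, q x y * kern s (x - y) ≤
      constC (n + 1) s * ENNReal.ofReal (ε ^ (-s) / s) := by
    intro y hy
    have h1 := lintegral_mul_kern hs0 (g := (Iio (y 0 - ε)).indicator 1)
      (measurable_one.indicator measurableSet_Iio) y
    have h2 := lintegral_Iio_abs_sub hs0 (show y 0 - ε < y 0 by linarith)
    rw [sub_sub_cancel, ← lintegral_indicator measurableSet_Iio] at h2
    have hpy : Measurable fun x => p x y := hpm.comp measurable_prodMk_left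
    rw [← h2, ← lintegral_add_left (by fun_prop)]
    have h3 : ∀ t, (Iio (y 0 - ε)).indicator 1 t * ENNReal.ofReal (|t - y 0| ^ (-(1 + s))) =
        (Iio (y 0 - ε)).indicator (fun t => ENNReal.ofReal (|t - y 0| ^ (-(1 + s)))) t := by
      intro t
      by_cases ht : t ∈ Iio (y 0 - ε) <;> simp [ht]
    simp_rw [h3] at h1
    rw [← h1]
    refine lintegral_mono fun x => ?_
    rw [← add_mul]
    refine mul_le_mul_left ?_ _
    have hy0 : 0 < y 0 := hε.trans hy
    rcases lt_trichotomy (x 0) 0 with hx | hx | hx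
    · have : x 0 < y 0 - ε := by linarith
      simp [p, q, hx, hy0, this, not_lt.2 hx.le]
    · simp [p, q, hx]
    · by_cases hxy : x 0 + ε < y 0
      · have : x 0 < y 0 - ε := by linarith
        simp [p, q, hx, this, not_lt.2 hx.le, hxy]
      · simp [p, q, not_lt.2 hx.le, hxy]
  have hP : ∀ x, ε < x 0 → ∫⁻ y, p x y * kern s (x - y) =
      constC (n + 1) s * ENNReal.ofReal (ε ^ (-s) / s) := by
    intro x hx
    have h1 := lintegral_mul_kern hs0 (g := (Ioi (x 0 + ε)).indicator 1)
      (measurable_one.indicator measurableSet_Ioi) x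
    have h2 := lintegral_Ioi_abs_sub hs0 (show x 0 < x 0 + ε by linarith)
    rw [add_sub_cancel_left, ← lintegral_indicator measurableSet_Ioi] at h2
    rw [← h2]
    have hx0 : 0 < x 0 := hε.trans hx
    convert h1 using 3 with y
    · rw [kern_sub_comm]
      by_cases hy : x 0 + ε < y 0 <;> simp [p, hx0, hy]
    · funext t
      by_cases ht : t ∈ Ioi (x 0 + ε) <;> simp [ht]
  have hA2 : W ≤ ∫⁻ y, ∫⁻ x, q x y * (‖u x - u y‖ₑ * kern s (x - y)) := by
    refine lintegral_mono fun y => ?_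
    by_cases hy : u y = 0
    · simp [hy]
    simp only
    rw [← hQ y (hε.trans (hεu y hy)), ← lintegral_const_mul' _ _ enorm_ne_top]
    refine lintegral_mono fun x => ?_
    by_cases hx : x 0 < 0
    · have hux : u x = 0 := by
        by_contra h
        linarith [hεu x h]
      simp only [hux, zero_sub, enorm_neg]
      rw [mul_left_comm]
    · simp [q, hx]
  -- `S` is the downward mass weighted by `|u|`. The upward mass exceeds it by at least `W`, and `S`
  -- is finite, so it can be cancelled after the triangle inequality.
  set S := ∫⁻ y, ‖u y‖ₑ * ∫⁻ x, p x y * kern s (x - y) with hS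
  have hSW : S + W ≤ ∫⁻ y, ‖u y‖ₑ * (constC (n + 1) s * ENNReal.ofReal (ε ^ (-s) / s)) := by
    have hmeas : Measurable fun y => ∫⁻ x, p x y * kern s (x - y) :=
      Measurable.lintegral_prod_right' (f := fun z => p z.2 z.1 * kern s (z.2 - z.1)) (by fun_prop)
    rw [hS, hW, ← lintegral_add_left (by fun_prop)]
    refine lintegral_mono fun y => ?_
    by_cases hy : u y = 0
    · simp [hy]
    rw [← mul_add, ← hQ y (hε.trans (hεu y hy))]
    exact mul_le_mul_right (hPQ y (hεu y hy)) _
  have hfin : ∫⁻ y, ‖u y‖ₑ * (constC (n + 1) s * ENNReal.ofReal (ε ^ (-s) / s)) ≠ ⊤ := by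
    rw [lintegral_mul_const' _ _ (ENNReal.mul_ne_top hC ENNReal.ofReal_ne_top)]
    exact ENNReal.mul_ne_top (hu.1.continuous.integrable_of_hasCompactSupport hu.2.1).2.ne
      (ENNReal.mul_ne_top hC ENNReal.ofReal_ne_top)
  have hSfin : S ≠ ⊤ := ne_top_of_le_ne_top hfin (le_self_add.trans hSW)
  have hA1 : W ≤ ∫⁻ y, ∫⁻ x, p x y * (‖u x - u y‖ₑ * kern s (x - y)) := by
    have h1 : ∫⁻ y, ‖u y‖ₑ * (constC (n + 1) s * ENNReal.ofReal (ε ^ (-s) / s)) =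
        ∫⁻ y, ∫⁻ x, p x y * (‖u x‖ₑ * kern s (x - y)) := by
      rw [lintegral_lintegral_swap (by
        exact Measurable.aemeasurable (f := fun z : EuclideanSpace ℝ (Fin (n + 1)) ×
          EuclideanSpace ℝ (Fin (n + 1)) => p z.2 z.1 * (‖u z.2‖ₑ * kern s (z.2 - z.1)))
          (by fun_prop))]
      refine lintegral_congr fun x => ?_
      by_cases hx : u x = 0
      · simp [hx]
      rw [← hP x (hεu x hx), ← lintegral_const_mul' _ _ enorm_ne_top]
      exact lintegral_congr fun y => mul_left_comm _ _ _
    have h2 : ∫⁻ y, ∫⁻ x, p x y * (‖u x‖ₑ * kern s (x - y)) ≤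
        S + ∫⁻ y, ∫⁻ x, p x y * (‖u x - u y‖ₑ * kern s (x - y)) := by
      have hmeas : Measurable fun y => ∫⁻ x, p x y * kern s (x - y) :=
        Measurable.lintegral_prod_right' (f := fun z => p z.2 z.1 * kern s (z.2 - z.1))
          (by fun_prop)
      rw [hS, ← lintegral_add_left (by fun_prop)]
      refine lintegral_mono fun y => ?_
      have hpy : Measurable fun x => p x y := hpm.comp measurable_prodMk_left
      simp only
      rw [← lintegral_const_mul' _ _ enorm_ne_top, ← lintegral_add_left (by fun_prop)]
      refine lintegral_mono fun x => ?_
      have htri : ‖u x‖ₑ ≤ ‖u y‖ₑ + ‖u x - u y‖ₑ := by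
        calc ‖u x‖ₑ = ‖u y + (u x - u y)‖ₑ := by rw [add_sub_cancel]
          _ ≤ _ := enorm_add_le _ _
      calc p x y * (‖u x‖ₑ * kern s (x - y))
          ≤ p x y * ((‖u y‖ₑ + ‖u x - u y‖ₑ) * kern s (x - y)) := by gcongr
        _ = _ := by ring
    rw [← h1] at h2
    exact (ENNReal.add_le_add_iff_left hSfin).1 (hSW.trans h2)
  calc ENNReal.ofReal (4 / s) * constC (n + 1) s * hardyL1 s (halfSpace (n + 1)) u
      = 2 * (W + W) := by
        rw [show (4 : ℝ) / s = 4 * (1 / s) by ring, ENNReal.ofReal_mul (by norm_num),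
          ENNReal.ofReal_ofNat, hardyL1, ← two_mul, ← mul_assoc,
          show (2 : ℝ≥0∞) * 2 = 4 by norm_num, mul_assoc, mul_assoc]
        congr 1
        rw [← lintegral_const_mul' _ _ hC, ← lintegral_const_mul' _ _ ENNReal.ofReal_ne_top,
          ← lintegral_indicator isOpen_halfSpace.measurableSet]
        refine lintegral_congr fun y => ?_
        by_cases hy : y ∈ halfSpace (n + 1)
        · have hy0 : 0 < y 0 := hy
          rw [indicator_of_mem hy, bdryDist_halfSpace hy, Real.rpow_neg hy0.le, div_eq_mul_one_div (_⁻¹),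
            ENNReal.ofReal_mul (by positivity)]
          ring
        · have huy : u y = 0 := image_eq_zero_of_notMem_tsupport fun h => hy (hu.2.2 h)
          simp [indicator_of_notMem hy, huy]
    _ ≤ 2 * ∫⁻ y, ∫⁻ x, (p x y + q x y) * (‖u x - u y‖ₑ * kern s (x - y)) := by
        refine mul_le_mul_right ((add_le_add hA1 hA2).trans (le_of_eq ?_)) _
        rw [← lintegral_add_left (Measurable.lintegral_prod_right'
          (f := fun z => p z.2 z.1 * (‖u z.2 - u z.1‖ₑ * kern s (z.2 - z.1))) (by fun_prop))]
        refine lintegral_congr fun y => ?_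
        have hpy : Measurable fun x => p x y := hpm.comp measurable_prodMk_left
        rw [← lintegral_add_left (by fun_prop)]
        exact lintegral_congr fun x => (add_mul _ _ _).symm
    _ ≤ energy s u := by
        refine two_mul_lintegral_le_energy s hum hm fun x y => ?_
        simp only [p, q, indicator_apply, mem_ofPred_eq, Pi.one_apply]
        split_ifs <;> first | (exfalso; linarith) | simp

end LowerBounds

/-! ### Transplanting test functions from the half-space into a convex set. -/

section ConvexUpperBound

variable {N : ℕ} {s : ℝ}

theorem lintegral_comp_similarity
    (T : EuclideanSpace ℝ (Fin N) ≃ₗᵢ[ℝ] EuclideanSpace ℝ (Fin N)) (z : EuclideanSpace ℝ (Fin N))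
    {l : ℝ} (hl : 0 < l) {f : EuclideanSpace ℝ (Fin N) → ℝ≥0∞} (hf : Measurable f) :
    ∫⁻ y, f y = ENNReal.ofReal (l ^ N) * ∫⁻ k, f (l • T k + z) := by
  have hT : Measurable T := T.continuous.measurable
  rw [← lintegral_add_right_eq_self _ z,
    lintegral_comp_smul_of_pos volume (f := fun y => f (y + z)) (by fun_prop) hl,
    finrank_euclideanSpace_fin,
    ← T.measurePreserving.lintegral_comp (f := fun y => f (l • y + z)) (by fun_prop)]

/-- Small copies of a compact subset of the half-space fit into a convex set, next to a point where
an interior ball touches the boundary. -/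
theorem exists_similarity_into_convex [NeZero N] {Ω K : Set (EuclideanSpace ℝ (Fin N))}
    (hΩ : IsOpen Ω) (hconv : Convex ℝ Ω) (hne : Ω.Nonempty) (hfr : (frontier Ω).Nonempty)
    (hK : IsCompact K) (hKH : K ⊆ halfSpace N) :
    ∃ (T : EuclideanSpace ℝ (Fin N) ≃ₗᵢ[ℝ] EuclideanSpace ℝ (Fin N))
      (z : EuclideanSpace ℝ (Fin N)) (l : ℝ), 0 < l ∧
      ∀ k ∈ K, l • T k + z ∈ Ω ∧ bdryDist Ω (l • T k + z) ≤ l * k 0 := by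
  obtain ⟨x, hx⟩ := hne
  obtain ⟨z, hz, hdz⟩ := isClosed_frontier.exists_infDist_eq_dist hfr x
  have hzΩ : z ∉ Ω := fun h => (disjoint_frontier_iff_isOpen.2 hΩ).le_bot ⟨hz, h⟩
  obtain ⟨ν, hν, hsep⟩ := exists_unit_normal hΩ hconv ⟨x, hx⟩ hzΩ
  set r := bdryDist Ω x with hr
  have hr0 : 0 < r := bdryDist_pos hΩ hfr hx
  have hrz : ‖x - z‖ = r := by rw [← dist_eq_norm, ← hdz, hr, bdryDist]
  -- Equality in Cauchy–Schwarz: `r ≤ ⟪ν, z - x⟫ ≤ ‖z - x‖ = r`. The separating hyperplane is thus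
  -- tangent to the interior ball at `z`.
  have hxz : z - x = r • ν := by
    have h1 := bdryDist_le_of_normal hΩ hν hsep hx
    rw [← inner_neg_right, neg_sub, ← hr] at h1
    have h2 : ‖(z - x) - r • ν‖ ^ 2 ≤ 0 := by
      rw [norm_sub_sq_real, norm_sub_rev, hrz, norm_smul, hν, real_inner_smul_right,
        real_inner_comm, Real.norm_of_nonneg hr0.le]
      nlinarith
    have h3 : ‖(z - x) - r • ν‖ = 0 := by
      have := norm_nonneg ((z - x) - r • ν)
      nlinarith
    exact sub_eq_zero.1 (norm_eq_zero.1 h3)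
  obtain ⟨T, hT⟩ := exists_isometry_inner_eq (ν := -ν) (by rwa [norm_neg])
  -- The image of `k` lies in the ball of radius `r` about `x` as soon as `l * ‖k‖ ^ 2 < 2 * r * k
  -- 0`, so a bound on `‖k‖ ^ 2 / k 0` fixes how small `l` must be. The summand `1` keeps the
  -- denominator positive.
  obtain ⟨B, hB⟩ := hK.exists_bound_of_continuousOn (f := fun k => ‖k‖ ^ 2 / k 0) (by
    refine ContinuousOn.div (by fun_prop) (by fun_prop) fun k hk => ?_
    exact (show 0 < k 0 from hKH hk).ne')
  have hl0 : 0 < r / (|B| + 1) := by positivity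
  refine ⟨T, z, r / (|B| + 1), hl0, fun k hk => ?_⟩
  have hk0 : 0 < k 0 := hKH hk
  set l := r / (|B| + 1) with hl
  have hνT : ⟪ν, T k⟫_ℝ = -k 0 := by rw [← hT k, inner_neg_left, neg_neg]
  have hlk : l * ‖k‖ ^ 2 < 2 * r * k 0 := by
    have h1 := (le_abs_self _).trans (hB k hk)
    rw [div_le_iff₀ hk0] at h1
    have h2 : l * |B| ≤ r := by
      rw [hl, div_mul_eq_mul_div, div_le_iff₀ (by positivity)]
      nlinarith
    have h3 : B * k 0 ≤ |B| * k 0 := mul_le_mul_of_nonneg_right (le_abs_self B) hk0.le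
    calc l * ‖k‖ ^ 2 ≤ l * (|B| * k 0) := mul_le_mul_of_nonneg_left (h1.trans h3) hl0.le
      _ = l * |B| * k 0 := by ring
      _ ≤ r * k 0 := mul_le_mul_of_nonneg_right h2 hk0.le
      _ < 2 * r * k 0 := by nlinarith
  have hmem : l • T k + z ∈ Ω := by
    refine ball_bdryDist_subset hΩ hx ?_
    rw [mem_ball_iff_norm, ← hr, add_sub_assoc, hxz]
    refine lt_of_pow_lt_pow_left₀ 2 hr0.le ?_
    rw [norm_add_sq_real, norm_smul, norm_smul, hν, T.norm_map, real_inner_smul_left,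
      real_inner_smul_right, real_inner_comm, hνT, Real.norm_of_nonneg hr0.le,
      Real.norm_of_nonneg hl0.le]
    nlinarith
  refine ⟨hmem, (bdryDist_le_of_normal hΩ hν hsep hmem).trans (le_of_eq ?_)⟩
  rw [add_sub_cancel_right, real_inner_smul_right, hνT]
  ring

theorem hardyConst_le_halfSpace [NeZero N] (hs0 : 0 < s) {Ω : Set (EuclideanSpace ℝ (Fin N))}
    (hΩ : IsOpen Ω) (hconv : Convex ℝ Ω) (hne : Ω.Nonempty) (hfr : (frontier Ω).Nonempty) :
    hardyConst s 1 Ω ≤ hardyConst s 1 (halfSpace N) := by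
  refine le_hardyConst fun u hu => ?_
  obtain ⟨T, z, l, hl, hTK⟩ := exists_similarity_into_convex hΩ hconv hne hfr hu.2.1 hu.2.2
  set g : EuclideanSpace ℝ (Fin N) → EuclideanSpace ℝ (Fin N) := fun y => l⁻¹ • T.symm (y - z)
    with hg
  have hgΦ : ∀ k, g (l • T k + z) = k := fun k => by
    simp [hg, smul_smul, hl.ne']
  have hΦg : ∀ y, l • T (g y) + z = y := fun y => by
    simp [hg, smul_smul, hl.ne']
  have hTc : Continuous T := T.continuous
  have hTm : Measurable T := hTc.measurable
  have hgsm : ContDiff ℝ ∞ g :=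
    (T.symm.contDiff.comp (contDiff_id.sub contDiff_const)).const_smul l⁻¹
  have hum : Measurable u := hu.1.continuous.measurable
  have hgm : Measurable g := hgsm.continuous.measurable
  set v : EuclideanSpace ℝ (Fin N) → ℝ := fun y => u (g y) with hv
  have hK : IsCompact ((fun k => l • T k + z) '' tsupport u) :=
    IsCompact.image hu.2.1 (by fun_prop)
  have hvK : ∀ y, y ∉ (fun k => l • T k + z) '' tsupport u → v y = 0 := fun y hy =>
    image_eq_zero_of_notMem_tsupport (f := u) fun h => hy ⟨g y, h, hΦg y⟩
  have hvt : v ∈ testFunctions Ω := by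
    refine ⟨hu.1.comp hgsm, HasCompactSupport.intro hK hvK, ?_⟩
    refine (closure_minimal (fun y hy => ?_) hK.isClosed).trans
      (image_subset_iff.2 fun k hk => (hTK k hk).1)
    by_contra h
    exact hy (hvK y h)
  have hkern : ∀ w, kern s (l • T w) = ENNReal.ofReal (l ^ (-((N : ℝ) + s))) * kern s w := by
    intro w
    rw [kern, kern, norm_smul, T.norm_map, Real.norm_of_nonneg hl.le,
      Real.mul_rpow hl.le (norm_nonneg _), mul_inv, ENNReal.ofReal_mul (by positivity),
      Real.rpow_neg hl.le]
  have hk := measurable_kern (N := N) s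
  -- The common scaling factor `l^{N-s}`: the energy gains `l^{2N}` from two changes of variables
  -- and `l^{-(N+s)}` from the kernel. The Hardy integral scales only up to an inequality, by `d_Ω ≤
  -- l k₀`.
  set c := ENNReal.ofReal (l ^ N) * ENNReal.ofReal (l ^ (-s)) with hc
  have hc0 : c ≠ 0 := by
    rw [hc, ← ENNReal.ofReal_mul (by positivity)]
    exact (ENNReal.ofReal_pos.2 (by positivity)).ne'
  have hct : c ≠ ⊤ := ENNReal.mul_ne_top ENNReal.ofReal_ne_top ENNReal.ofReal_ne_top
  have hvm : Measurable v := by fun_prop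
  have hE : energy s v = c * energy s u := by
    have hF : Measurable fun p : EuclideanSpace ℝ (Fin N) × EuclideanSpace ℝ (Fin N) =>
      ‖v p.2 - v p.1‖ₑ * kern s (p.2 - p.1) := by fun_prop
    rw [energy, lintegral_comp_similarity T z hl hF.lintegral_prod_right', hc, mul_assoc, energy,
      ← lintegral_const_mul' (ENNReal.ofReal (l ^ (-s))) _ ENNReal.ofReal_ne_top]
    congr 1
    refine lintegral_congr fun y => ?_
    have hFy : Measurable fun x => ‖v x - v (l • T y + z)‖ₑ * kern s (x - (l • T y + z)) := by
      fun_prop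
    simp only
    rw [lintegral_comp_similarity T z hl hFy, ← lintegral_const_mul' _ _ ENNReal.ofReal_ne_top,
      ← lintegral_const_mul' _ _ ENNReal.ofReal_ne_top]
    refine lintegral_congr fun x => ?_
    rw [add_sub_add_right_eq_sub, ← smul_sub, ← map_sub, hkern]
    simp only [hv, hgΦ]
    rw [show l ^ (-s) = l ^ N * l ^ (-((N : ℝ) + s)) by
      rw [← Real.rpow_natCast, ← Real.rpow_add hl]; congr 1; ring,
      ENNReal.ofReal_mul (by positivity)]
    ring
  have hI : c * hardyL1 s (halfSpace N) u ≤ hardyL1 s Ω v := by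
    have hm : Measurable (Ω.indicator fun y => ‖v y‖ₑ * ENNReal.ofReal (bdryDist Ω y ^ s)⁻¹) := by
      have hd : Measurable (bdryDist Ω) := (Metric.continuous_infDist_pt _).measurable
      have hvd : Measurable fun y => ‖v y‖ₑ * ENNReal.ofReal (bdryDist Ω y ^ s)⁻¹ := by fun_prop
      exact hvd.indicator hΩ.measurableSet
    rw [hardyL1, hardyL1, ← lintegral_indicator hΩ.measurableSet,
      ← lintegral_indicator isOpen_halfSpace.measurableSet, lintegral_comp_similarity T z hl hm, hc,
      mul_assoc,
      ← lintegral_const_mul' (ENNReal.ofReal (l ^ (-s))) _ ENNReal.ofReal_ne_top]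
    refine mul_le_mul_right (lintegral_mono fun k => ?_) _
    by_cases hku : k ∈ tsupport u
    · obtain ⟨h1, h2⟩ := hTK k hku
      have hkH : k ∈ halfSpace N := hu.2.2 hku
      have hk0 : 0 < k 0 := hkH
      simp only [indicator_of_mem hkH, indicator_of_mem h1, hv, hgΦ, bdryDist_halfSpace hkH]
      rw [mul_left_comm, ← ENNReal.ofReal_mul (by positivity)]
      gcongr 1
      refine ENNReal.ofReal_le_ofReal ?_
      rw [Real.rpow_neg hl.le, ← mul_inv, ← Real.mul_rpow hl.le hk0.le]
      have hd := bdryDist_pos hΩ hfr h1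
      gcongr
    · have huk : u k = 0 := image_eq_zero_of_notMem_tsupport hku
      refine le_of_eq_of_le ?_ zero_le
      simp only [mul_eq_zero, indicator_apply_eq_zero]
      exact Or.inr fun _ => by simp [huk]
  have h := (mul_le_mul_right hI (hardyConst s 1 Ω)).trans (hardyConst_mul_le hΩ hfr hvt)
  rw [hE, mul_left_comm] at h
  exact (ENNReal.mul_le_mul_iff_right hc0 hct).1 h

end ConvexUpperBound

/-! ### Fractional energy on the line: intervals and mollification. -/

/-- The one-dimensional `W^{s,1}` energy. -/
noncomputable def lineEnergy (s : ℝ) (f : ℝ → ℝ) : ℝ≥0∞ :=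
  ∫⁻ y, ∫⁻ x, ‖f x - f y‖ₑ * ENNReal.ofReal (|x - y| ^ (-(1 + s)))

section Line

variable {s : ℝ}

theorem lintegral_Ioo_sub_left (hs1 : s < 1) {a b : ℝ} (hab : a ≤ b) :
    ∫⁻ y in Ioo a b, ENNReal.ofReal ((y - a) ^ (-s)) =
      ENNReal.ofReal ((b - a) ^ (1 - s) / (1 - s)) := by
  have h := lintegral_Ioo_rpow_neg hs1 le_rfl (sub_nonneg.2 hab)
  rw [Real.zero_rpow (by linarith), sub_zero] at h
  rw [← h, ← lintegral_indicator measurableSet_Ioo, ← lintegral_indicator measurableSet_Ioo,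
    ← lintegral_add_right_eq_self _ a]
  refine lintegral_congr fun t => ?_
  simp only [indicator_apply, mem_Ioo, add_sub_cancel_right, lt_add_iff_pos_left, lt_sub_iff_add_lt]

theorem lintegral_Ioo_sub_right (hs1 : s < 1) {a b : ℝ} (hab : a ≤ b) :
    ∫⁻ y in Ioo a b, ENNReal.ofReal ((b - y) ^ (-s)) =
      ENNReal.ofReal ((b - a) ^ (1 - s) / (1 - s)) := by
  rw [← lintegral_Ioo_sub_left hs1 hab, ← lintegral_indicator measurableSet_Ioo,
    ← lintegral_indicator measurableSet_Ioo, ← lintegral_sub_left_eq_self _ (a + b)]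
  refine lintegral_congr fun t => ?_
  have h1 : (a + b - t ∈ Ioo a b) ↔ t ∈ Ioo a b := by
    simp only [mem_Ioo]; constructor <;> rintro ⟨h1, h2⟩ <;> constructor <;> linarith
  simp only [indicator_apply, h1, show b - (a + b - t) = t - a by ring]

theorem lineEnergy_indicator_Ioo_le (hs0 : 0 < s) (hs1 : s < 1) {a b : ℝ} (hab : a ≤ b) :
    lineEnergy s ((Ioo a b).indicator 1) ≤
      ENNReal.ofReal (4 * (b - a) ^ (1 - s) / (s * (1 - s))) := by
  set k : ℝ → ℝ≥0∞ := fun t => ENNReal.ofReal (|t| ^ (-(1 + s))) with hk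
  have hkm : Measurable k := by fun_prop
  set I : ℝ → ℝ≥0∞ := (Ioo a b).indicator 1 with hI
  set J : ℝ → ℝ≥0∞ := (Ioo a b)ᶜ.indicator 1 with hJ
  have hIm : Measurable I := measurable_one.indicator measurableSet_Ioo
  have hJm : Measurable J := measurable_one.indicator measurableSet_Ioo.compl
  have hF : Measurable fun p : ℝ × ℝ => I p.1 * J p.2 * k (p.2 - p.1) := by fun_prop
  have hsplit : lineEnergy s ((Ioo a b).indicator 1) =
      2 * ∫⁻ y, ∫⁻ x, I y * J x * k (x - y) := by
    have hswap : ∫⁻ y, ∫⁻ x, I y * J x * k (x - y) = ∫⁻ y, ∫⁻ x, I x * J y * k (x - y) := by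
      rw [lintegral_lintegral_swap hF.aemeasurable]
      refine lintegral_congr fun x => lintegral_congr fun y => ?_
      simp only [hk, abs_sub_comm]
    rw [two_mul]
    nth_rewrite 2 [hswap]
    rw [← lintegral_add_left hF.lintegral_prod_right', lineEnergy]
    refine lintegral_congr fun y => ?_
    have hFy : Measurable fun x => I y * J x * k (x - y) := by fun_prop
    simp only
    rw [← lintegral_add_left hFy]
    refine lintegral_congr fun x => ?_
    by_cases hx : x ∈ Ioo a b <;> by_cases hy : y ∈ Ioo a b <;> simp [I, J, hx, hy, hk]
  have hinner : ∀ y ∈ Ioo a b, ∫⁻ x, I y * J x * k (x - y) ≤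
      ENNReal.ofReal (1 / s) * (ENNReal.ofReal ((y - a) ^ (-s)) + ENNReal.ofReal ((b - y) ^ (-s)))
      := by
    intro y hy
    have h1 := lintegral_Iio_abs_sub hs0 hy.1
    have h2 := lintegral_Ioi_abs_sub hs0 hy.2
    rw [div_eq_mul_one_div, mul_comm, ENNReal.ofReal_mul (by positivity)] at h1 h2
    -- The endpoints belong to the complement of the open interval, so the half-lines are closed up
    -- to cover it pointwise.
    rw [mul_add, ← h1, ← h2, restrict_Iio_eq_restrict_Iic, restrict_Ioi_eq_restrict_Ici,
      ← lintegral_indicator measurableSet_Iic, ← lintegral_indicator measurableSet_Ici,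
      ← lintegral_add_left (by
        exact Measurable.indicator (by fun_prop) measurableSet_Iic)]
    refine lintegral_mono fun x => ?_
    by_cases hxa : x ≤ a
    · have : x ∉ Ioo a b := fun h => absurd h.1 (not_lt.2 hxa)
      simp [I, J, hy, this, hxa, hk]
    · by_cases hxb : b ≤ x
      · have : x ∉ Ioo a b := fun h => absurd h.2 (not_lt.2 hxb)
        simp [I, J, hy, this, hxb, hk]
      · have : x ∈ Ioo a b := ⟨not_le.1 hxa, not_le.1 hxb⟩
        simp [J, this]
  have hab' : 0 ≤ b - a := sub_nonneg.2 hab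
  have h1s : 0 < 1 - s := sub_pos.2 hs1
  rw [hsplit]
  calc 2 * ∫⁻ y, ∫⁻ x, I y * J x * k (x - y)
      ≤ 2 * ∫⁻ y in Ioo a b, ENNReal.ofReal (1 / s) *
          (ENNReal.ofReal ((y - a) ^ (-s)) + ENNReal.ofReal ((b - y) ^ (-s))) := by
        rw [← lintegral_indicator measurableSet_Ioo]
        refine mul_le_mul_right (lintegral_mono fun y => ?_) _
        by_cases hy : y ∈ Ioo a b
        · rw [indicator_of_mem hy]; exact hinner y hy
        · simp [I, hy]
    _ = ENNReal.ofReal (4 * (b - a) ^ (1 - s) / (s * (1 - s))) := by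
        rw [lintegral_const_mul' _ _ ENNReal.ofReal_ne_top, lintegral_add_left (by fun_prop),
          lintegral_Ioo_sub_left hs1 hab, lintegral_Ioo_sub_right hs1 hab,
          ← ENNReal.ofReal_add (by positivity) (by positivity),
          ← ENNReal.ofReal_mul (by positivity), ← ENNReal.ofReal_ofNat 2,
          ← ENNReal.ofReal_mul (by positivity)]
        congr 1
        field_simp
        ring

/-- Convolution with a probability density does not increase the fractional energy or the
`L¹` norm. -/
theorem convolution_normed_bounds {f : ℝ → ℝ} (hfm : Measurable f) (hf : LocallyIntegrable f)
    (ρ : ContDiffBump (0 : ℝ)) :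
    lineEnergy s (convolution (ρ.normed volume) f (ContinuousLinearMap.lsmul ℝ ℝ) volume) ≤
        lineEnergy s f ∧
      ∫⁻ x, ‖convolution (ρ.normed volume) f (ContinuousLinearMap.lsmul ℝ ℝ) volume x‖ₑ ≤
        ∫⁻ x, ‖f x‖ₑ := by
  set w := ρ.normed volume with hw
  set g := convolution w f (ContinuousLinearMap.lsmul ℝ ℝ) volume with hg
  have hwc : Continuous w := ρ.continuous_normed
  have hwm : Measurable w := hwc.measurable
  have hw1 : ∫⁻ t, ‖w t‖ₑ = 1 := by
    have h1 := ofReal_integral_eq_lintegral_ofReal (ρ.integrable_normed (μ := volume))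
      (ae_of_all _ ρ.nonneg_normed)
    rw [ρ.integral_normed, ENNReal.ofReal_one] at h1
    rw [h1]
    exact lintegral_congr fun t => Real.enorm_eq_ofReal (ρ.nonneg_normed t)
  have hex : ∀ x, Integrable fun t => w t * f (x - t) := fun x =>
    ρ.hasCompactSupport_normed.convolutionExists_left (ContinuousLinearMap.lsmul ℝ ℝ) hwc hf x
  have hgx : ∀ x, g x = ∫ t, w t * f (x - t) := fun x => rfl
  have hdiff : ∀ x y, ‖g x - g y‖ₑ ≤ ∫⁻ t, ‖w t‖ₑ * ‖f (x - t) - f (y - t)‖ₑ := by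
    intro x y
    rw [hgx, hgx, ← integral_sub (hex x) (hex y)]
    refine (enorm_integral_le_lintegral_enorm _).trans (le_of_eq (lintegral_congr fun t => ?_))
    rw [← mul_sub, enorm_mul]
  constructor
  · calc lineEnergy s g
        ≤ ∫⁻ y, ∫⁻ x, ∫⁻ t, ‖w t‖ₑ * ‖f (x - t) - f (y - t)‖ₑ *
            ENNReal.ofReal (|x - y| ^ (-(1 + s))) := by
          refine lintegral_mono fun y => lintegral_mono fun x => ?_
          simp only
          rw [lintegral_mul_const' _ _ ENNReal.ofReal_ne_top]
          exact mul_le_mul_left (hdiff x y) _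
      _ = ∫⁻ y, ∫⁻ t, ∫⁻ x, ‖w t‖ₑ * ‖f (x - t) - f (y - t)‖ₑ *
            ENNReal.ofReal (|x - y| ^ (-(1 + s))) := by
          refine lintegral_congr fun y => ?_
          rw [lintegral_lintegral_swap]
          exact Measurable.aemeasurable (by fun_prop)
      _ = ∫⁻ t, ∫⁻ y, ∫⁻ x, ‖w t‖ₑ * ‖f (x - t) - f (y - t)‖ₑ *
            ENNReal.ofReal (|x - y| ^ (-(1 + s))) := by
          rw [lintegral_lintegral_swap]
          exact Measurable.aemeasurable (Measurable.lintegral_prod_right'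
            (f := fun q : (ℝ × ℝ) × ℝ => ‖w q.1.2‖ₑ * ‖f (q.2 - q.1.2) - f (q.1.1 - q.1.2)‖ₑ *
              ENNReal.ofReal (|q.2 - q.1.1| ^ (-(1 + s)))) (by fun_prop))
      _ = ∫⁻ t, ‖w t‖ₑ * lineEnergy s f := by
          refine lintegral_congr fun t => ?_
          rw [lineEnergy, ← lintegral_const_mul' _ _ enorm_ne_top,
            ← lintegral_add_right_eq_self _ t]
          refine lintegral_congr fun y => ?_
          rw [← lintegral_const_mul' _ _ enorm_ne_top, ← lintegral_add_right_eq_self _ t]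
          refine lintegral_congr fun x => ?_
          rw [add_sub_cancel_right, add_sub_cancel_right, add_sub_add_right_eq_sub, mul_assoc]
      _ = lineEnergy s f := by
          rw [lintegral_mul_const _ (by fun_prop), hw1, one_mul]
  · calc ∫⁻ x, ‖g x‖ₑ ≤ ∫⁻ x, ∫⁻ t, ‖w t‖ₑ * ‖f (x - t)‖ₑ := by
          refine lintegral_mono fun x => ?_
          simp only
          rw [hgx]
          refine (enorm_integral_le_lintegral_enorm _).trans (le_of_eq (lintegral_congr fun t => ?_))
          rw [enorm_mul]
      _ = ∫⁻ t, ∫⁻ x, ‖w t‖ₑ * ‖f (x - t)‖ₑ := by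
          rw [lintegral_lintegral_swap]
          exact Measurable.aemeasurable (by fun_prop)
      _ = ∫⁻ t, ‖w t‖ₑ * ∫⁻ x, ‖f x‖ₑ := by
          refine lintegral_congr fun t => ?_
          rw [lintegral_const_mul' _ _ enorm_ne_top, lintegral_sub_right_eq_self (fun x => ‖f x‖ₑ)]
      _ = ∫⁻ x, ‖f x‖ₑ := by
          rw [lintegral_mul_const _ (by fun_prop), hw1, one_mul]

theorem exists_smooth_near_indicator (hs0 : 0 < s) (hs1 : s < 1) {ε l : ℝ} (hε : 0 < ε)
    (hl : 0 ≤ l) : ∃ φ : ℝ → ℝ, ContDiff ℝ ∞ φ ∧ (∀ t ∉ Icc ε (l + 3 * ε), φ t = 0) ∧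
      (∀ t ∈ Ioo (3 * ε) l, φ t = 1) ∧
      lineEnergy s φ ≤ ENNReal.ofReal (4 * l ^ (1 - s) / (s * (1 - s))) ∧
      ∫⁻ t, ‖φ t‖ₑ ≤ ENNReal.ofReal l := by
  -- The interval is shifted by `2 * ε` so that mollifying at radius `ε` keeps the support at
  -- distance `ε` from `0`; its length, hence the energy bound, remains that of `(0, l)`.
  set χ : ℝ → ℝ := (Ioo (2 * ε) (l + 2 * ε)).indicator 1 with hχ
  have hχm : Measurable χ := measurable_one.indicator measurableSet_Ioo
  have hχi : Integrable χ := by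
    rw [hχ, integrable_indicator_iff measurableSet_Ioo]
    exact integrableOn_const (by simp) (by simp)
  set ρ : ContDiffBump (0 : ℝ) := ⟨ε / 2, ε, by positivity, by linarith⟩ with hρ
  have hout : ρ.rOut = ε := rfl
  obtain ⟨h1, h2⟩ := convolution_normed_bounds (s := s) hχm hχi.locallyIntegrable ρ
  refine ⟨convolution (ρ.normed volume) χ (ContinuousLinearMap.lsmul ℝ ℝ) volume, ?_, ?_, ?_,
    h1.trans ?_, h2.trans ?_⟩
  · exact ρ.hasCompactSupport_normed.contDiff_convolution_left _ ρ.contDiff_normed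
      hχi.locallyIntegrable
  · intro t ht
    have h0 : ∀ x ∈ Metric.ball t ρ.rOut, χ x = 0 := by
      intro x hx
      rw [hout, Metric.mem_ball, Real.dist_eq, abs_lt] at hx
      refine indicator_of_notMem (fun hx' => ht ?_) _
      have h3 := hx'.1
      have h4 := hx'.2
      constructor <;> linarith
    have ht0 : χ t = 0 := h0 t (Metric.mem_ball_self ρ.rOut_pos)
    rw [ρ.normed_convolution_eq_right (fun x hx => by rw [h0 x hx, ht0]), ht0]
  · intro t ht
    have h0 : ∀ x ∈ Metric.ball t ρ.rOut, χ x = 1 := by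
      intro x hx
      rw [hout, Metric.mem_ball, Real.dist_eq, abs_lt] at hx
      have hm : x ∈ Ioo (2 * ε) (l + 2 * ε) := ⟨by linarith [ht.1], by linarith [ht.2]⟩
      rw [hχ, indicator_of_mem hm, Pi.one_apply]
    have ht0 : χ t = 1 := h0 t (Metric.mem_ball_self ρ.rOut_pos)
    rw [ρ.normed_convolution_eq_right (fun x hx => by rw [h0 x hx, ht0]), ht0]
  · have := lineEnergy_indicator_Ioo_le hs0 hs1 (show 2 * ε ≤ l + 2 * ε by linarith)
    rwa [add_sub_cancel_right] at this
  · have : ∀ t, ‖χ t‖ₑ = (Ioo (2 * ε) (l + 2 * ε)).indicator 1 t := by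
      intro t
      by_cases ht : t ∈ Ioo (2 * ε) (l + 2 * ε) <;> simp only [hχ, ht, indicator_of_mem,
        indicator_of_notMem, not_false_eq_true, Pi.one_apply, enorm_one, enorm_zero]
    simp_rw [this]
    rw [lintegral_indicator_one measurableSet_Ioo, Real.volume_Ioo, add_sub_cancel_right]

end Line

/-! ### Product test functions and the upper bound for the half-space. -/

section Product

variable {n : ℕ} {s : ℝ}

theorem continuous_consE :
    Continuous fun p : ℝ × EuclideanSpace ℝ (Fin n) => consE p.1 p.2 := by
  unfold consE
  refine (PiLp.continuous_toLp 2 _).comp (continuous_pi fun i => ?_)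
  refine Fin.cases ?_ (fun i => ?_) i
  · exact continuous_fst
  · simp only [Fin.cons_succ]; fun_prop

theorem contDiff_tailE : ContDiff ℝ ∞ (tailE (n := n)) := by
  rw [contDiff_euclidean]
  intro i
  exact (EuclideanSpace.proj (𝕜 := ℝ) i.succ).contDiff

theorem tailE_add (x y : EuclideanSpace ℝ (Fin (n + 1))) :
    tailE (x + y) = tailE x + tailE y := by
  ext i; simp [tailE]

theorem norm_tailE_le (x : EuclideanSpace ℝ (Fin (n + 1))) : ‖tailE x‖ ≤ ‖x‖ := by
  refine le_of_sq_le_sq ?_ (norm_nonneg x)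
  have := norm_consE_sq (x 0) (tailE x)
  rw [consE_tailE] at this
  rw [this]
  exact le_add_of_nonneg_left (sq_nonneg _)

theorem lintegral_mul_consE {f : ℝ → ℝ≥0∞} {g : EuclideanSpace ℝ (Fin n) → ℝ≥0∞}
    (hf : Measurable f) (hg : Measurable g) :
    ∫⁻ x : EuclideanSpace ℝ (Fin (n + 1)), f (x 0) * g (tailE x) = (∫⁻ t, f t) * ∫⁻ z, g z := by
  rw [lintegral_consE (by fun_prop)]
  simp only [consE_zero, tailE_consE]
  rw [← lintegral_mul_const _ hf]
  exact lintegral_congr fun t => lintegral_const_mul _ hg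

/-- The tangential contribution to the energy of a product function. -/
noncomputable def tangentialEnergy (s : ℝ) (ψ : EuclideanSpace ℝ (Fin n) → ℝ) : ℝ≥0∞ :=
  ∫⁻ z, ∫⁻ w : EuclideanSpace ℝ (Fin (n + 1)), ‖ψ (tailE w + z) - ψ z‖ₑ * kern s w

/-- The increment of `ψ` is at most `min 1 (L ‖w‖)` and vanishes unless `z` or its translate meets
the compact support. -/
theorem tangentialEnergy_ne_top (hs0 : 0 < s) (hs1 : s < 1)
    {ψ : EuclideanSpace ℝ (Fin n) → ℝ} (hψ : ContDiff ℝ ∞ ψ) (hc : HasCompactSupport ψ)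
    (h01 : ∀ z, ψ z ∈ Icc (0 : ℝ) 1) : tangentialEnergy s ψ ≠ ⊤ := by
  obtain ⟨L, hL⟩ := hψ.lipschitzWith_of_hasCompactSupport hc (by simp)
  have hψm : Measurable ψ := hψ.continuous.measurable
  have hk := measurable_kern (N := n + 1) s
  set S := tsupport ψ with hS
  have hSm : MeasurableSet S := (isClosed_tsupport ψ).measurableSet
  have hSfin : volume S ≠ ⊤ := hc.measure_lt_top.ne
  set M : EuclideanSpace ℝ (Fin (n + 1)) → ℝ≥0∞ := fun w => ENNReal.ofReal (min 1 (L * ‖w‖))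
    with hM
  have hMm : Measurable M := by fun_prop
  have hpt : ∀ w : EuclideanSpace ℝ (Fin (n + 1)), ∀ z, ‖ψ (tailE w + z) - ψ z‖ₑ ≤
      M w * (S.indicator 1 (tailE w + z) + S.indicator 1 z) := by
    intro w z
    by_cases h : tailE w + z ∈ S ∨ z ∈ S
    · have h1 : ‖ψ (tailE w + z) - ψ z‖ₑ ≤ M w := by
        rw [Real.enorm_eq_ofReal_abs]
        refine ENNReal.ofReal_le_ofReal (le_min ?_ ?_)
        · have h2 := h01 (tailE w + z)
          have h3 := h01 z
          rw [abs_le]; constructor <;> linarith [h2.1, h2.2, h3.1, h3.2]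
        · rw [← Real.dist_eq]
          refine (hL.dist_le_mul _ _).trans ?_
          rw [dist_eq_norm, add_sub_cancel_right]
          exact mul_le_mul_of_nonneg_left (norm_tailE_le w) L.2
      have h2 : (1 : ℝ≥0∞) ≤ S.indicator 1 (tailE w + z) + S.indicator 1 z := by
        rcases h with h | h <;> simp [h]
      exact h1.trans (le_mul_of_one_le_right zero_le h2)
    · push Not at h
      rw [image_eq_zero_of_notMem_tsupport h.1, image_eq_zero_of_notMem_tsupport h.2]
      simp
  have hsw : tangentialEnergy s ψ =
      ∫⁻ w : EuclideanSpace ℝ (Fin (n + 1)), ∫⁻ z, ‖ψ (tailE w + z) - ψ z‖ₑ * kern s w := by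
    rw [tangentialEnergy, lintegral_lintegral_swap]
    exact Measurable.aemeasurable (by fun_prop)
  have hind : Measurable (S.indicator (1 : EuclideanSpace ℝ (Fin n) → ℝ≥0∞)) :=
    measurable_one.indicator hSm
  have hle : tangentialEnergy s ψ ≤
      ∫⁻ w : EuclideanSpace ℝ (Fin (n + 1)), (M w * kern s w) * (volume S + volume S) := by
    rw [hsw]
    refine lintegral_mono fun w => ?_
    calc ∫⁻ z, ‖ψ (tailE w + z) - ψ z‖ₑ * kern s w
        ≤ ∫⁻ z, (M w * kern s w) * (S.indicator 1 (tailE w + z) + S.indicator 1 z) := by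
          refine lintegral_mono fun z => ?_
          simp only
          rw [mul_right_comm]
          exact mul_le_mul_left (hpt w z) _
      _ = (M w * kern s w) * (volume S + volume S) := by
          rw [lintegral_const_mul _ (by fun_prop), lintegral_add_left (by fun_prop),
            lintegral_add_left_eq_self (S.indicator 1), lintegral_indicator_one hSm]
  refine ne_top_of_le_ne_top ?_ hle
  rw [lintegral_mul_const _ (by fun_prop)]
  exact ENNReal.mul_ne_top (lintegral_min_mul_kern_ne_top hs0 hs1 L.2)
    (ENNReal.add_ne_top.2 ⟨hSfin, hSfin⟩)

/-- Telescope the difference of products into `(φ(x₀) - φ(y₀)) ψ(y') + φ(x₀) (ψ(x') - ψ(y'))`. In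
the first term only `φ` varies, so the kernel reduces to the line; in the second `φ` enters only
through its `L¹` norm. -/
theorem energy_product_le (hs0 : 0 < s) {φ : ℝ → ℝ} {ψ : EuclideanSpace ℝ (Fin n) → ℝ}
    (hφ : Measurable φ) (hψ : Measurable ψ) :
    energy s (fun x : EuclideanSpace ℝ (Fin (n + 1)) => φ (x 0) * ψ (tailE x)) ≤
      constC (n + 1) s * lineEnergy s φ * (∫⁻ z, ‖ψ z‖ₑ) +
        (∫⁻ t, ‖φ t‖ₑ) * tangentialEnergy s ψ := by
  have hk := measurable_kern (N := n + 1) s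
  set A : EuclideanSpace ℝ (Fin (n + 1)) → EuclideanSpace ℝ (Fin (n + 1)) → ℝ≥0∞ := fun y x =>
    ‖φ (x 0) - φ (y 0)‖ₑ * kern s (x - y) * ‖ψ (tailE y)‖ₑ with hA
  set B : EuclideanSpace ℝ (Fin (n + 1)) → EuclideanSpace ℝ (Fin (n + 1)) → ℝ≥0∞ := fun y x =>
    ‖φ (x 0)‖ₑ * (‖ψ (tailE x) - ψ (tailE y)‖ₑ * kern s (x - y)) with hB
  have hAm : Measurable (Function.uncurry A) := by
    simp only [Function.uncurry_def, hA]; fun_prop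
  have hBm : Measurable (Function.uncurry B) := by
    simp only [Function.uncurry_def, hB]; fun_prop
  have hle : energy s (fun x : EuclideanSpace ℝ (Fin (n + 1)) => φ (x 0) * ψ (tailE x)) ≤
      (∫⁻ y, ∫⁻ x, A y x) + ∫⁻ y, ∫⁻ x, B y x := by
    rw [← lintegral_add_left (f := fun y => ∫⁻ x, A y x) hAm.lintegral_prod_right']
    refine lintegral_mono fun y => ?_
    have hAy : Measurable (A y) := hAm.of_uncurry_left
    change _ ≤ (∫⁻ x, A y x) + _
    rw [← lintegral_add_left hAy]
    refine lintegral_mono fun x => ?_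
    simp only [hA, hB]
    calc ‖φ (x 0) * ψ (tailE x) - φ (y 0) * ψ (tailE y)‖ₑ * kern s (x - y)
        = ‖(φ (x 0) - φ (y 0)) * ψ (tailE y) + φ (x 0) * (ψ (tailE x) - ψ (tailE y))‖ₑ *
            kern s (x - y) := by congr 2; ring
      _ ≤ (‖(φ (x 0) - φ (y 0)) * ψ (tailE y)‖ₑ + ‖φ (x 0) * (ψ (tailE x) - ψ (tailE y))‖ₑ) *
            kern s (x - y) := mul_le_mul_left (enorm_add_le _ _) _
      _ = _ := by rw [enorm_mul, enorm_mul]; ring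
  have hAeq : ∫⁻ y, ∫⁻ x, A y x = constC (n + 1) s * lineEnergy s φ * (∫⁻ z, ‖ψ z‖ₑ) := by
    have hin : ∀ y, ∫⁻ x, A y x = constC (n + 1) s *
        ((fun b => ∫⁻ a, ‖φ a - φ b‖ₑ * ENNReal.ofReal (|a - b| ^ (-(1 + s)))) (y 0) *
          (fun z => ‖ψ z‖ₑ) (tailE y)) := by
      intro y
      simp only [hA]
      rw [lintegral_mul_const' _ _ enorm_ne_top,
        lintegral_mul_kern hs0 (g := fun a => ‖φ a - φ (y 0)‖ₑ) (by fun_prop), mul_assoc]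
    have hm : Measurable fun b => ∫⁻ a, ‖φ a - φ b‖ₑ * ENNReal.ofReal (|a - b| ^ (-(1 + s))) :=
      Measurable.lintegral_prod_right'
        (f := fun p : ℝ × ℝ => ‖φ p.2 - φ p.1‖ₑ * ENNReal.ofReal (|p.2 - p.1| ^ (-(1 + s))))
        (by fun_prop)
    simp_rw [hin]
    rw [lintegral_const_mul' _ _ (constC_succ_ne_top hs0), lintegral_mul_consE (g := fun z => ‖ψ z‖ₑ) hm (by fun_prop),
      lineEnergy, mul_assoc]
  have hBeq : ∫⁻ y, ∫⁻ x, B y x = (∫⁻ t, ‖φ t‖ₑ) * tangentialEnergy s ψ := by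
    have hm : Measurable fun z => ∫⁻ w : EuclideanSpace ℝ (Fin (n + 1)),
        ‖ψ (tailE w + z) - ψ z‖ₑ * kern s w :=
      Measurable.lintegral_prod_right'
        (f := fun p : EuclideanSpace ℝ (Fin n) × EuclideanSpace ℝ (Fin (n + 1)) =>
          ‖ψ (tailE p.2 + p.1) - ψ p.1‖ₑ * kern s p.2) (by fun_prop)
    rw [lintegral_lintegral_swap hBm.aemeasurable, tangentialEnergy,
      ← lintegral_mul_consE (f := fun t => ‖φ t‖ₑ) (by fun_prop) hm]
    refine lintegral_congr fun x => ?_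
    simp only [hB]
    rw [lintegral_const_mul' _ _ enorm_ne_top, ← lintegral_add_right_eq_self _ x]
    congr 1
    refine lintegral_congr fun w => ?_
    rw [tailE_add, kern_sub_comm, add_sub_cancel_right, ← enorm_neg, neg_sub]
  rw [← hAeq, ← hBeq]
  exact hle

theorem product_mem_testFunctions {φ : ℝ → ℝ} {ψ : EuclideanSpace ℝ (Fin n) → ℝ}
    (hφ : ContDiff ℝ ∞ φ) (hψ : ContDiff ℝ ∞ ψ) (hc : HasCompactSupport ψ) {a b : ℝ} (ha : 0 < a)
    (hφ0 : ∀ t ∉ Icc a b, φ t = 0) :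
    (fun x : EuclideanSpace ℝ (Fin (n + 1)) => φ (x 0) * ψ (tailE x)) ∈
      testFunctions (halfSpace (n + 1)) := by
  have hK : IsCompact ((fun p : ℝ × EuclideanSpace ℝ (Fin n) => consE p.1 p.2) ''
      (Icc a b ×ˢ tsupport ψ)) := (isCompact_Icc.prod hc).image continuous_consE
  have h0 : ∀ x, x ∉ (fun p : ℝ × EuclideanSpace ℝ (Fin n) => consE p.1 p.2) ''
      (Icc a b ×ˢ tsupport ψ) → φ (x 0) * ψ (tailE x) = 0 := by
    intro x hx
    by_cases h1 : x 0 ∈ Icc a b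
    · have h2 : tailE x ∉ tsupport ψ := fun h2 => hx ⟨(x 0, tailE x), ⟨h1, h2⟩, consE_tailE x⟩
      rw [image_eq_zero_of_notMem_tsupport h2, mul_zero]
    · rw [hφ0 _ h1, zero_mul]
  refine ⟨?_, HasCompactSupport.intro hK h0, ?_⟩
  · exact (hφ.comp (EuclideanSpace.proj (𝕜 := ℝ) (0 : Fin (n + 1))).contDiff).mul
      (hψ.comp contDiff_tailE)
  · refine (closure_minimal (fun x hx => ?_) hK.isClosed).trans ?_
    · by_contra h
      exact hx (h0 x h)
    · rintro _ ⟨p, hp, rfl⟩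
      exact ha.trans_le hp.1.1

theorem le_hardyL1_product (hs1 : s < 1) {φ : ℝ → ℝ} {ψ : EuclideanSpace ℝ (Fin n) → ℝ}
    (hψ : Measurable ψ) {a b : ℝ} (ha : 0 ≤ a) (hab : a ≤ b)
    (h1 : ∀ t ∈ Ioo a b, φ t = 1) :
    ENNReal.ofReal ((b ^ (1 - s) - a ^ (1 - s)) / (1 - s)) * (∫⁻ z, ‖ψ z‖ₑ) ≤
      hardyL1 s (halfSpace (n + 1)) fun x => φ (x 0) * ψ (tailE x) := by
  have hf : Measurable ((Ioo a b).indicator fun t : ℝ => ENNReal.ofReal (t ^ (-s))) :=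
    Measurable.indicator (by fun_prop) measurableSet_Ioo
  rw [← lintegral_Ioo_rpow_neg hs1 ha hab, ← lintegral_indicator measurableSet_Ioo,
    ← lintegral_mul_consE hf (by fun_prop), hardyL1,
    ← lintegral_indicator isOpen_halfSpace.measurableSet]
  refine lintegral_mono fun x => ?_
  by_cases hx : x 0 ∈ Ioo a b
  · have hx0 : 0 < x 0 := ha.trans_lt hx.1
    have hxH : x ∈ halfSpace (n + 1) := hx0
    simp only [indicator_of_mem hx, indicator_of_mem hxH, h1 _ hx, one_mul,
      bdryDist_halfSpace hxH, Real.rpow_neg hx0.le]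
    rw [mul_comm]
  · simp [indicator_of_notMem hx]

theorem hardyConst_halfSpace_le (hs0 : 0 < s) (hs1 : s < 1) :
    hardyConst s 1 (halfSpace (n + 1)) ≤ ENNReal.ofReal (4 / s) * constC (n + 1) s := by
  set h := hardyConst s 1 (halfSpace (n + 1)) with hh
  set C := constC (n + 1) s with hC
  have hCt : C ≠ ⊤ := constC_succ_ne_top hs0
  have h1s : 0 < 1 - s := sub_pos.2 hs1
  set ψ : ContDiffBump (0 : EuclideanSpace ℝ (Fin n)) := ⟨1, 2, one_pos, one_lt_two⟩
  set A := ∫⁻ z, ‖ψ z‖ₑ with hA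
  set B := tangentialEnergy s ψ with hB
  have hBt : B ≠ ⊤ := tangentialEnergy_ne_top hs0 hs1 ψ.contDiff ψ.hasCompactSupport
    fun z => ⟨ψ.nonneg, ψ.le_one⟩
  have hψm : Measurable ψ := ψ.continuous.measurable
  have hAt : A ≠ ⊤ := (ψ.continuous.integrable_of_hasCompactSupport ψ.hasCompactSupport).2.ne
  have hA0 : A ≠ 0 := by
    have h1 : ∫ z, ψ z ≤ A.toReal := by
      refine (le_abs_self _).trans ?_
      rw [← Real.norm_eq_abs, hA, ← integral_norm_eq_lintegral_enorm
        ψ.continuous.aestronglyMeasurable]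
      exact norm_integral_le_integral_norm _
    have h2 := ψ.integral_pos (μ := volume)
    intro h0
    rw [h0] at h1
    simp at h1
    linarith
  -- The Hardy inequality for `φ ψ`, divided by `l^{1-s} / (1-s)`. With mollification scale `l ^ 2 /
  -- 3`, `φ = 1` on `(l ^ 2, l)`, and the loss near `0` is of relative size `l^{1-s}`.
  have key : ∀ l ∈ Ioo (0 : ℝ) 1, h * A * ENNReal.ofReal (1 - l ^ (1 - s)) ≤
      ENNReal.ofReal (4 / s) * C * A + ENNReal.ofReal ((1 - s) * l ^ s) * B := by
    intro l hl
    have hl0 : 0 < l := hl.1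
    have hll : l ^ 2 ≤ l := by nlinarith [hl.2]
    obtain ⟨φ, hφ, hφ0, hφ1, hφE, hφL⟩ := exists_smooth_near_indicator hs0 hs1
      (show 0 < l ^ 2 / 3 by positivity) hl0.le
    have h3 : 3 * (l ^ 2 / 3) = l ^ 2 := by ring
    rw [h3] at hφ1
    have hφm : Measurable φ := hφ.continuous.measurable
    have hu := product_mem_testFunctions (n := n) hφ ψ.contDiff ψ.hasCompactSupport
      (show 0 < l ^ 2 / 3 by positivity) hφ0
    have h4 := (mul_le_mul_right (le_hardyL1_product hs1 hψm (sq_nonneg l) hll hφ1) h).trans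
      ((hardyConst_mul_le isOpen_halfSpace frontier_halfSpace_nonempty hu).trans
        (energy_product_le hs0 hφm hψm))
    have h5 : h * (ENNReal.ofReal ((l ^ (1 - s) - (l ^ 2) ^ (1 - s)) / (1 - s)) * A) ≤
        C * ENNReal.ofReal (4 * l ^ (1 - s) / (s * (1 - s))) * A + ENNReal.ofReal l * B :=
      h4.trans (by gcongr)
    have h6 := mul_le_mul_right h5 (ENNReal.ofReal ((1 - s) * l ^ (-(1 - s))))
    have hp : 0 < l ^ (1 - s) := by positivity
    have e1 : (1 - s) * l ^ (-(1 - s)) * ((l ^ (1 - s) - (l ^ 2) ^ (1 - s)) / (1 - s)) =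
        1 - l ^ (1 - s) := by
      rw [Real.rpow_neg hl0.le, show l ^ 2 = l * l by ring, Real.mul_rpow hl0.le hl0.le]
      field_simp
    have e2 : (1 - s) * l ^ (-(1 - s)) * (4 * l ^ (1 - s) / (s * (1 - s))) = 4 / s := by
      rw [Real.rpow_neg hl0.le]
      field_simp
    have e3 : (1 - s) * l ^ (-(1 - s)) * l = (1 - s) * l ^ s := by
      rw [mul_assoc, ← Real.rpow_add_one hl0.ne']
      congr 2; ring
    calc h * A * ENNReal.ofReal (1 - l ^ (1 - s))
        = ENNReal.ofReal ((1 - s) * l ^ (-(1 - s))) *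
            (h * (ENNReal.ofReal ((l ^ (1 - s) - (l ^ 2) ^ (1 - s)) / (1 - s)) * A)) := by
          rw [← e1, ENNReal.ofReal_mul (by positivity)]
          ac_rfl
      _ ≤ _ := h6
      _ = _ := by
          rw [← e2, ← e3, ENNReal.ofReal_mul (p := (1 - s) * l ^ (-(1 - s))) (by positivity),
            ENNReal.ofReal_mul (p := (1 - s) * l ^ (-(1 - s))) (by positivity), mul_add]
          congr 1 <;> ac_rfl
  have hlim : h * A ≤ ENNReal.ofReal (4 / s) * C * A := by
    have hev : ∀ᶠ l : ℝ in 𝓝[>] 0, l ∈ Ioo (0 : ℝ) 1 := Ioo_mem_nhdsGT one_pos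
    have t1 : Tendsto (fun l : ℝ => h * A * ENNReal.ofReal (1 - l ^ (1 - s))) (𝓝[>] 0)
        (𝓝 (h * A)) := by
      have hc : ContinuousAt (fun l : ℝ => 1 - l ^ (1 - s)) 0 :=
        continuousAt_const.sub (Real.continuousAt_rpow_const 0 (1 - s) (Or.inr h1s.le))
      have h1 := ENNReal.tendsto_ofReal hc.tendsto
      rw [Real.zero_rpow h1s.ne', sub_zero, ENNReal.ofReal_one] at h1
      have h2 := ENNReal.Tendsto.const_mul (a := h * A) h1 (Or.inl one_ne_zero)
      rw [mul_one] at h2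
      exact h2.mono_left nhdsWithin_le_nhds
    have t2 : Tendsto (fun l : ℝ => ENNReal.ofReal (4 / s) * C * A +
        ENNReal.ofReal ((1 - s) * l ^ s) * B) (𝓝[>] 0) (𝓝 (ENNReal.ofReal (4 / s) * C * A)) := by
      have hc : ContinuousAt (fun l : ℝ => (1 - s) * l ^ s) 0 :=
        continuousAt_const.mul (Real.continuousAt_rpow_const 0 s (Or.inr hs0.le))
      have h1 := ENNReal.tendsto_ofReal hc.tendsto
      rw [Real.zero_rpow hs0.ne', mul_zero, ENNReal.ofReal_zero] at h1
      have h2 := ENNReal.Tendsto.mul_const (b := B) h1 (Or.inr hBt)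
      rw [zero_mul] at h2
      have h3 := (tendsto_const_nhds (x := ENNReal.ofReal (4 / s) * C * A)).add h2
      rw [add_zero] at h3
      exact h3.mono_left nhdsWithin_le_nhds
    exact le_of_tendsto_of_tendsto t1 t2 (hev.mono key)
  exact (ENNReal.mul_le_mul_iff_left hA0 hAt).1 hlim

end Product

end FracHardy

/-! ### Assembly of the bounds. -/

theorem theorem1p1 (N : ℕ) [NeZero N] (s : ℝ) (hs0 : 0 < s) (hs1 : s < 1) :
    hardyConst s 1 (halfSpace N) = constLambda s 1 * constC N s ∧
    constLambda s 1 = ENNReal.ofReal (4 / s) ∧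
    ∀ Ω : Set (EuclideanSpace ℝ (Fin N)), IsOpen Ω → Convex ℝ Ω → Ω.Nonempty → Ω ≠ Set.univ →
      hardyConst s 1 (halfSpace N) / 2 ≤ hardyConst s 1 Ω ∧
      hardyConst s 1 Ω ≤ hardyConst s 1 (halfSpace N) := by
  obtain ⟨n, rfl⟩ := Nat.exists_eq_succ_of_ne_zero (NeZero.ne N)
  have hH : hardyConst s 1 (halfSpace (n + 1)) = ENNReal.ofReal (4 / s) * constC (n + 1) s :=
    le_antisymm (hardyConst_halfSpace_le hs0 hs1) (halfSpace_le_hardyConst hs0)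
  refine ⟨by rw [constLambda_one hs0 hs1]; exact hH, constLambda_one hs0 hs1,
    fun Ω hΩ hconv hne huniv => ?_⟩
  have hfr : (frontier Ω).Nonempty := nonempty_frontier_iff.2 ⟨hne, huniv⟩
  refine ⟨?_, hardyConst_le_halfSpace hs0 hΩ hconv hne hfr⟩
  refine le_trans (le_of_eq ?_) (convex_le_hardyConst hs0 hΩ hconv hfr)
  refine (congrArg (· / 2) hH).trans ?_
  rw [ENNReal.div_eq_inv_mul, ← mul_assoc, show (2 : ℝ) / s = 2⁻¹ * (4 / s) by ring,
    ENNReal.ofReal_mul (by norm_num), ENNReal.ofReal_inv_of_pos two_pos, ENNReal.ofReal_ofNat]
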